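/- Let $n\ge 1$, $\mathbb F=\mathbb Q(q,t)$ and $\mathbb K=\mathbb Q(q,t,a)$ with $q,t,a$ indeterminates, $x=(x_1,\dots,x_n)$, $\tau=(1,t^{-1},\dots,t^{1-n})$ and $\mathcal C_n=(\mathbb Z_{\ge 0})^n$. For $v\in\mathbb Z^n$ put $|v|=v_1+\cdots+v_n$ and $\overline v=(\overline v_1,\dots,\overline v_n)\in\mathbb F^n$, where $$\overline v_i=q^{v_i}t^{-k_i(v)},\qquad k_i(v)=\#\{k<i\mid v_k\ge v_i\}+\#\{k>i\mid v_k>v_i\}.$$ For $\alpha\in\mathcal C_n$ let $G_\alpha\in\mathbb F[x]$ be the non-symmetric interpolation Macdonald polynomial: the polynomial of degree at most $|\alpha|$ with $G_\alpha(\overline\beta)=0$ for all $\beta\in\mathcal C_n$ with $|\beta|\le|\alpha|$, $\beta\ne\alpha$, in which the coefficient of $x^\alpha$ is $1$. Put $K_\alpha(x)=G_\alpha(x)/G_\alpha(a\tau)\in\mathbb K[x]$. For $v\in\mathbb Z^n$ define $K_v\in\mathbb K(x)$ by $$K_v(x)=A_m(x;v)\,K_{v+(m^n)}(q^mx),\qquad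 A_m(x;v)=\prod_{i=1}^n\frac{(q^{1-m}a\overline v_i^{-1};q)_m}{(qt^{n-1}x_i;q)_m},$$ where $m\in\mathbb Z_{\ge0}$ is such that $v+(m^n)\in\mathcal C_n$ (with $(m^n)=(m,\dots,m)$), and $(y;q)_m=\prod_{j=0}^{m-1}(1-q^jy)$. Let $\mathcal F$ be the space of $\mathbb K(x)$-valued functions on $\mathbb Z^n$ and $K\in\mathcal F$ the function $v\mapsto K_v$. The symmetric group acts on $\mathbb K(x)$ by permuting variables, $s_i$ interchanging $x_i$ and $x_{i+1}$, and on $\mathbb Z^n$ by permuting entries. On $\mathbb K(x)$ consider the $\mathbb K$-linear operators $$H_i=t+\frac{x_i-tx_{i+1}}{x_i-x_{i+1}}(s_i-1)\ (1\le i<n),\qquad \Delta f(x_1,\dots,x_n)=f(q^{-1}x_n,x_1,\dots,x_{n-1}),$$ $$\Phi=(x_n-t^{1-n})\Delta,\qquad \Xi_j=\frac1{x_j}+\frac1{x_j}H_j\cdots H_{n-1}\,\Phi\, H_1\cdots H_{j-1}\ (1\le j\le n),$$ acting on $\mathcal F$ through the values of functions. On $\mathcal F$ consider also the $\mathbb K(x)$-linear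 operators $$(\widehat H_if)(v)=tf(v)+\frac{\overline v_i-t\overline v_{i+1}}{\overline v_i-\overline v_{i+1}}\bigl(f(s_iv)-f(v)\bigr),\qquad (\widehat x_jf)(v)=a\overline v_jf(v),$$ $$(\widehat\Delta f)(v)=f(v_n-1,v_1,\dots,v_{n-1}),\qquad(\widehat\Delta^{-1}f)(v)=f(v_2,\dots,v_n,v_1+1).$$ Then the following hold. For every $\alpha\in\mathcal C_n$ the polynomial $G_\alpha$ exists and is unique, and $G_\alpha(a\tau)\neq0$; $K_v$ does not depend on the choice of $m$, and it agrees with the polynomial $K_\alpha$ when $v=\alpha\in\mathcal C_n$. Moreover, as identities in $\mathcal F$, 1. $H_iK=\widehat H_iK$ for $1\le i<n$; 2. $\Xi_jK=a\,\widehat x_j^{-1}K$ for $1\le j\le n$; 3. $\Phi K=t^{1-n}(a^2\widehat x_1^{-1}-1)\widehat\Delta^{-1}K$. -/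

import Mathlib

namespace InterpolationMacdonald

noncomputable section

/-! ### Fields

Throughout, the number of variables is `n + 1` with `n : ℕ`, so that indices `1, …, N` of the
mathematical notation (`N = n + 1 ≥ 1`) correspond to `0, …, n`, that is, to `Fin (n + 1)`.
The exponent `1 - N` is therefore `-n`. -/

/-- The field `𝔽 = ℚ(q, t)`. -/
abbrev FF : Type := FractionRing (MvPolynomial (Fin 2) ℚ)

/-- The field `𝕂 = ℚ(q, t, a) = 𝔽(a)`. -/
abbrev KK : Type := RatFunc FF

/-- The indeterminate `q` in `𝔽`. -/
def qF : FF := algebraMap (MvPolynomial (Fin 2) ℚ) FF (MvPolynomial.X 0)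

/-- The indeterminate `t` in `𝔽`. -/
def tF : FF := algebraMap (MvPolynomial (Fin 2) ℚ) FF (MvPolynomial.X 1)

/-- The indeterminate `q` in `𝕂`. -/
def qK : KK := algebraMap FF KK qF

/-- The indeterminate `t` in `𝕂`. -/
def tK : KK := algebraMap FF KK tF

/-- The indeterminate `a` in `𝕂`. -/
def aK : KK := RatFunc.X

lemma qF_ne_zero : qF ≠ 0 := by
  simp [qF, MvPolynomial.X_ne_zero]

lemma tF_ne_zero : tF ≠ 0 := by
  simp [tF, MvPolynomial.X_ne_zero]

lemma qK_ne_zero : qK ≠ 0 := by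
  simpa [qK] using qF_ne_zero

lemma aK_ne_zero : aK ≠ 0 := RatFunc.X_ne_zero

/-- The polynomial ring `𝕂[x]` in `n + 1` variables. -/
abbrev KPoly (n : ℕ) : Type := MvPolynomial (Fin (n + 1)) KK

/-- The field of rational functions `𝕂(x)` in `n + 1` variables. -/
abbrev KRat (n : ℕ) : Type := FractionRing (KPoly n)

/-- The variable `x_j` in `𝕂(x)`. -/
def xvar (n : ℕ) (j : Fin (n + 1)) : KRat n := algebraMap (KPoly n) (KRat n) (MvPolynomial.X j)

/-! ### Spectral points -/

/-- `k_i(v) = #{k < i | v_k ≥ v_i} + #{k > i | v_k > v_i}`. -/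
def kIndex {n : ℕ} (v : Fin (n + 1) → ℤ) (i : Fin (n + 1)) : ℕ :=
  (Finset.univ.filter fun k => k < i ∧ v i ≤ v k).card +
    (Finset.univ.filter fun k => i < k ∧ v i < v k).card

/-- The spectral point `v̄ ∈ 𝔽ⁿ⁺¹` with coordinates `q ^ (v_i) * t ^ (-k_i(v))`. -/
def barF {n : ℕ} (v : Fin (n + 1) → ℤ) (i : Fin (n + 1)) : FF :=
  qF ^ (v i) * tF ^ (-(kIndex v i : ℤ))

/-- The spectral point `v̄` with coordinates regarded in `𝕂`. -/
def barK {n : ℕ} (v : Fin (n + 1) → ℤ) (i : Fin (n + 1)) : KK :=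
  algebraMap FF KK (barF v i)

lemma barF_ne_zero {n : ℕ} (v : Fin (n + 1) → ℤ) (i : Fin (n + 1)) : barF v i ≠ 0 :=
  mul_ne_zero (zpow_ne_zero _ qF_ne_zero) (zpow_ne_zero _ tF_ne_zero)

lemma barK_ne_zero {n : ℕ} (v : Fin (n + 1) → ℤ) (i : Fin (n + 1)) : barK v i ≠ 0 := by
  simpa [barK] using barF_ne_zero v i

/-- The point `aτ` with `τ_i = t ^ (1 - i)` (`1`-based `i`). -/
def aTau (n : ℕ) (i : Fin (n + 1)) : KK := aK * tK ^ (-(i : ℤ))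

/-! ### Interpolation polynomials -/

/-- `G` is the non-symmetric interpolation Macdonald polynomial of degree `α`: it has degree at
most `|α|`, vanishes at `β̄` for all compositions `β ≠ α` with `|β| ≤ |α|`, and the coefficient
of `x ^ α` in `G` is `1`. -/
structure IsInterpolation {n : ℕ} (α : Fin (n + 1) → ℕ) (G : MvPolynomial (Fin (n + 1)) FF) :
    Prop where
  degree_le : G.totalDegree ≤ ∑ i, α i
  vanishing : ∀ β : Fin (n + 1) → ℕ, ∑ i, β i ≤ ∑ i, α i → β ≠ α →
    MvPolynomial.eval (barF fun i => (β i : ℤ)) G = 0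
  coeff_eq_one : MvPolynomial.coeff (Finsupp.equivFunOnFinite.symm α) G = 1

/-- The non-symmetric interpolation Macdonald polynomial `G_α ∈ 𝔽[x]`. -/
def interpG {n : ℕ} (α : Fin (n + 1) → ℕ) : MvPolynomial (Fin (n + 1)) FF :=
  Classical.epsilon (IsInterpolation α)

/-- `G_α` regarded as an element of `𝕂[x]`. -/
def interpGK {n : ℕ} (α : Fin (n + 1) → ℕ) : KPoly n :=
  MvPolynomial.map (algebraMap FF KK) (interpG α)

/-- The evaluation `G_α(aτ) ∈ 𝕂`. -/
def evalG {n : ℕ} (α : Fin (n + 1) → ℕ) : KK :=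
  MvPolynomial.eval (aTau n) (interpGK α)

/-- The normalized polynomial `K_α = G_α / G_α(aτ) ∈ 𝕂[x]`. -/
def Kpoly {n : ℕ} (α : Fin (n + 1) → ℕ) : KPoly n :=
  MvPolynomial.C (evalG α)⁻¹ * interpGK α

/-! ### Extension to all integral vectors -/

/-- The `q`-shifted factorial `(y; q)_m = ∏_{j < m} (1 - q ^ j y)` in `𝕂(x)`. -/
def qPoch {n : ℕ} (y : KRat n) (m : ℕ) : KRat n :=
  ∏ j ∈ Finset.range m, (1 - algebraMap KK (KRat n) (qK ^ j) * y)

/-- The factor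
`A_m(x; v) = ∏_i (q ^ (1 - m) a v̄_i⁻¹; q)_m / (q t ^ (N - 1) x_i; q)_m`, where `N = n + 1`. -/
def factorA {n : ℕ} (m : ℕ) (v : Fin (n + 1) → ℤ) : KRat n :=
  ∏ i, qPoch (algebraMap KK (KRat n) (qK ^ (1 - (m : ℤ)) * aK * (barK v i)⁻¹)) m /
    qPoch (algebraMap KK (KRat n) (qK * tK ^ n) * xvar n i) m

/-- The rational function `A_m(x; v) K_{v + (m, …, m)}(q ^ m x)`; it is meant for those `m` for
which all entries of `v + (m, …, m)` are nonnegative. -/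
def shiftedK {n : ℕ} (m : ℕ) (v : Fin (n + 1) → ℤ) : KRat n :=
  factorA m v *
    MvPolynomial.aeval (fun i => algebraMap KK (KRat n) (qK ^ m) * xvar n i)
      (Kpoly fun i => (v i + m).toNat)

/-- The least `m : ℕ` for which all entries of `v + (m, …, m)` are nonnegative. -/
def minShift {n : ℕ} (v : Fin (n + 1) → ℤ) : ℕ :=
  Finset.univ.sup fun i => (-v i).toNat

/-- The space of `𝕂(x)`-valued functions on `ℤⁿ⁺¹`. -/
abbrev FunSpace (n : ℕ) : Type := (Fin (n + 1) → ℤ) → KRat n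

/-- The map `K : v ↦ K_v ∈ 𝕂(x)` on all integral vectors. -/
def Kext (n : ℕ) : FunSpace n := fun v => shiftedK (minShift v) v

/-! ### Operators on rational functions -/

/-- The automorphism of `𝕂(x)` interchanging `x_i` and `x_{i+1}`. -/
def swapVars (n : ℕ) (i : Fin n) : KRat n ≃ₐ[KK] KRat n :=
  IsFractionRing.fieldEquivOfAlgEquiv KK (KRat n) (KRat n)
    (MvPolynomial.renameEquiv KK (Equiv.swap i.castSucc i.succ))

/-- The automorphism `f(x_1, …, x_N) ↦ f(q⁻¹ x_N, x_1, …, x_{N-1})` of `𝕂[x]`. -/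
def deltaPoly (n : ℕ) : KPoly n ≃ₐ[KK] KPoly n :=
  AlgEquiv.ofAlgHom
    (MvPolynomial.aeval (Fin.cons (MvPolynomial.C qK⁻¹ * MvPolynomial.X (Fin.last n))
      fun i : Fin n => MvPolynomial.X i.castSucc))
    (MvPolynomial.aeval (Fin.snoc (fun i : Fin n => MvPolynomial.X i.succ)
      (MvPolynomial.C qK * MvPolynomial.X 0)))
    (by
      ext1 i
      refine Fin.lastCases ?_ (fun i => ?_) i
      · simp [← mul_assoc, ← MvPolynomial.C_mul, MvPolynomial.algebraMap_eq, qK_ne_zero]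
      · simp)
    (by
      ext1 i
      refine Fin.cases ?_ (fun i => ?_) i
      · simp [← mul_assoc, ← MvPolynomial.C_mul, MvPolynomial.algebraMap_eq, qK_ne_zero]
      · simp)

/-- The automorphism `Δ f(x_1, …, x_N) = f(q⁻¹ x_N, x_1, …, x_{N-1})` of `𝕂(x)`. -/
def Delta (n : ℕ) : KRat n ≃ₐ[KK] KRat n :=
  IsFractionRing.fieldEquivOfAlgEquiv KK (KRat n) (KRat n) (deltaPoly n)

/-- Multiplication by a rational function, as an operator on `𝕂(x)`. -/
def mulOp {n : ℕ} (g : KRat n) : Module.End KK (KRat n) := LinearMap.mulLeft KK g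

/-- The Demazure-Lusztig operator
`H_i = t + (x_i - t x_{i+1}) / (x_i - x_{i+1}) * (s_i - 1)` on `𝕂(x)`. -/
def HOp (n : ℕ) (i : Fin n) : Module.End KK (KRat n) :=
  tK • 1 +
    mulOp ((xvar n i.castSucc - algebraMap KK (KRat n) tK * xvar n i.succ) /
        (xvar n i.castSucc - xvar n i.succ)) *
      ((swapVars n i).toLinearMap - 1)

/-- The operator `Φ = (x_N - t ^ (1 - N)) Δ`, where `N = n + 1`. -/
def PhiOp (n : ℕ) : Module.End KK (KRat n) :=
  mulOp (xvar n (Fin.last n) - algebraMap KK (KRat n) (tK ^ (-(n : ℤ)))) *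
    (Delta n).toLinearMap

/-- The product `H_j H_{j+1} ⋯ H_{N-1}`. -/
def HFrom (n : ℕ) (j : Fin (n + 1)) : Module.End KK (KRat n) :=
  (((List.finRange n).filter fun i => j ≤ i.castSucc).map (HOp n)).prod

/-- The product `H_1 H_2 ⋯ H_{j-1}`. -/
def HUpTo (n : ℕ) (j : Fin (n + 1)) : Module.End KK (KRat n) :=
  (((List.finRange n).filter fun i => i.castSucc < j).map (HOp n)).prod

/-- The inhomogeneous Cherednik operator
`Ξ_j = x_j⁻¹ + x_j⁻¹ H_j ⋯ H_{N-1} Φ H_1 ⋯ H_{j-1}`. -/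
def XiOp (n : ℕ) (j : Fin (n + 1)) : Module.End KK (KRat n) :=
  mulOp (xvar n j)⁻¹ + mulOp (xvar n j)⁻¹ * (HFrom n j * PhiOp n * HUpTo n j)

/-- An operator on `𝕂(x)` acts on `𝕂(x)`-valued functions on `ℤⁿ⁺¹` by acting on the values. -/
def onValues {n : ℕ} (T : Module.End KK (KRat n)) : Module.End KK (FunSpace n) :=
  LinearMap.compLeft T (Fin (n + 1) → ℤ)

/-! ### Operators acting on the degree variable -/

/-- The action of `s_i` on integral vectors, interchanging the entries `v_i` and `v_{i+1}`. -/
def swapEntries {n : ℕ} (i : Fin n) (v : Fin (n + 1) → ℤ) : Fin (n + 1) → ℤ :=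
  v ∘ Equiv.swap i.castSucc i.succ

/-- `v^♮ = (v_2, …, v_N, v_1 + 1)`. -/
def natVec {n : ℕ} (v : Fin (n + 1) → ℤ) : Fin (n + 1) → ℤ :=
  Fin.snoc (Fin.tail v) (v 0 + 1)

/-- `v^♯ = (v_N - 1, v_1, …, v_{N-1})`. -/
def sharpVec {n : ℕ} (v : Fin (n + 1) → ℤ) : Fin (n + 1) → ℤ :=
  Fin.cons (v (Fin.last n) - 1) (Fin.init v)

lemma sharpVec_natVec {n : ℕ} (v : Fin (n + 1) → ℤ) : sharpVec (natVec v) = v := by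
  simp [sharpVec, natVec]

lemma natVec_sharpVec {n : ℕ} (v : Fin (n + 1) → ℤ) : natVec (sharpVec v) = v := by
  simp [sharpVec, natVec]

/-- `(Ĥ_i f)(v) = t f(v) + (v̄_i - t v̄_{i+1}) / (v̄_i - v̄_{i+1}) * (f(s_i v) - f(v))`. -/
def hatH (n : ℕ) (i : Fin n) : Module.End (KRat n) (FunSpace n) where
  toFun f v := tK • f v +
    ((barK v i.castSucc - tK * barK v i.succ) / (barK v i.castSucc - barK v i.succ)) •
      (f (swapEntries i v) - f v)
  map_add' f g := by
    funext v
    simp only [Pi.add_apply, Algebra.smul_def]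
    ring
  map_smul' c f := by
    funext v
    simp only [Pi.smul_apply, smul_eq_mul, Algebra.smul_def, RingHom.id_apply]
    ring

/-- `(Δ̂ f)(v) = f(v^♯)`, with inverse `(Δ̂⁻¹ f)(v) = f(v^♮)`. -/
def hatDelta (n : ℕ) : FunSpace n ≃ₗ[KRat n] FunSpace n where
  toFun f v := f (sharpVec v)
  invFun f v := f (natVec v)
  map_add' _ _ := rfl
  map_smul' _ _ := rfl
  left_inv f := by funext v; simp [sharpVec_natVec]
  right_inv f := by funext v; simp [natVec_sharpVec]

/-- `(x̂_j f)(v) = a v̄_j f(v)`, an invertible operator. -/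
def hatX (n : ℕ) (j : Fin (n + 1)) : FunSpace n ≃ₗ[KRat n] FunSpace n where
  toFun f v := (aK * barK v j) • f v
  invFun f v := (aK * barK v j)⁻¹ • f v
  map_add' f g := by funext v; simp
  map_smul' c f := by funext v; simp
  left_inv f := by
    funext v
    exact inv_smul_smul₀ (mul_ne_zero aK_ne_zero (barK_ne_zero v j)) (f v)
  right_inv f := by
    funext v
    exact smul_inv_smul₀ (mul_ne_zero aK_ne_zero (barK_ne_zero v j)) (f v)

end

end InterpolationMacdonald

open InterpolationMacdonald

/-!
Let `L_v` be the space of polynomials of degree at most `|v|` vanishing at `w̄` for all compositions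
`w ≠ v` with `|w| ≤ |v|`. A polynomial of degree at most `d` vanishing at all `w̄` with `|w| ≤ d`
restricts to zero on the hyperplane `x_N = t^(1-N)` by induction on the number of variables, hence
is `Φ` of a polynomial of smaller degree with the same property, hence is zero. So interpolation at
these points is unisolvent and `L_v` is a line, on which moreover the coefficient of `x^v` does not
vanish.

The operators act on spectral points: `Φ` maps `L_v` to `L_{v^♮}`, where
`v^♮ = (v_2, …, v_N, v_1 + 1)`, and `H_i` plus a scalar maps `L_v` to `L_{s_i v}`. The polynomial
`p + H_j ⋯ H_{N-1} Φ H_1 ⋯ H_{j-1} p` is divisible by `x_j`, and for `p ∈ L_v` the quotient again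
lies in `L_v`; its value at `v̄` gives the eigenvalue `v̄_j⁻¹` of `Ξ_j`. At a multiple of `τ` every
`H_i` is multiplication by `t`, so the case `j = 1` computes the value of `Φ p` at `aτ`. This shows
that `G_α(aτ) ≠ 0` and turns the maps between lines into the identities for `K_α`.

Applying `Φ` `N` times relates `K_v` and `K_{v + (1, …, 1)}(q x)`. The operator realizing this shift
commutes with all `H_i` and with `Φ`, so the identities descend from compositions to integral
vectors.
-/

namespace InterpolationMacdonald

open MvPolynomial

noncomputable section

section Generalities

variable {σ R : Type*} [CommRing R]

lemma dvd_algHom_sub_algHom {A : Type*} [CommRing A] [Algebra R A] (φ ψ : MvPolynomial σ R →ₐ[R] A)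
    (d : A) (h : ∀ i, d ∣ φ (X i) - ψ (X i)) (p : MvPolynomial σ R) : d ∣ φ p - ψ p := by
  simp only [← Ideal.mem_span_singleton, ← Ideal.Quotient.eq] at h ⊢
  have : (Ideal.Quotient.mkₐ R (Ideal.span {d})).comp φ =
      (Ideal.Quotient.mkₐ R (Ideal.span {d})).comp ψ := algHom_ext h
  exact DFunLike.congr_fun this p

lemma totalDegree_aeval_le {ι : Type*} (f : σ → MvPolynomial ι R)
    (hf : ∀ i, (f i).totalDegree ≤ 1) (p : MvPolynomial σ R) :
    (aeval f p).totalDegree ≤ p.totalDegree := by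
  rw [aeval_def, eval₂_eq]
  refine totalDegree_finsetSum_le fun m hm => ?_
  calc (algebraMap R (MvPolynomial ι R) (coeff m p) * ∏ i ∈ m.support, f i ^ m i).totalDegree
      ≤ (∏ i ∈ m.support, f i ^ m i).totalDegree := by
        simpa [algebraMap_eq] using totalDegree_mul (C (coeff m p)) (∏ i ∈ m.support, f i ^ m i)
    _ ≤ ∑ i ∈ m.support, (f i ^ m i).totalDegree := totalDegree_finsetProd _ _
    _ ≤ ∑ i ∈ m.support, m i := Finset.sum_le_sum fun i _ =>
        (totalDegree_pow _ _).trans (by simpa using Nat.mul_le_mul_left (m i) (hf i))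
    _ ≤ p.totalDegree := le_totalDegree hm

variable [Nontrivial R]

lemma totalDegree_X_sub_C (i : σ) (c : R) : (X i - C c : MvPolynomial σ R).totalDegree = 1 := by
  rw [sub_eq_add_neg, ← C_neg, totalDegree_add_eq_left_of_totalDegree_lt] <;> simp

lemma X_sub_C_ne_zero (i : σ) (c : R) : (X i - C c : MvPolynomial σ R) ≠ 0 := fun h => by
  simpa [h] using totalDegree_X_sub_C i c

lemma X_sub_X_ne_zero {i j : σ} (h : i ≠ j) : (X i - X j : MvPolynomial σ R) ≠ 0 :=
  sub_ne_zero.2 fun e => h (X_injective e)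

lemma totalDegree_X_sub_X {i j : σ} (h : i ≠ j) :
    (X i - X j : MvPolynomial σ R).totalDegree = 1 := by
  refine ((isHomogeneous_X R i).sub (isHomogeneous_X R j)).totalDegree (X_sub_X_ne_zero h)

end Generalities

/-! ### Spectral points -/

/-- The index `k_i(v)` as a single count, for vectors of any length including the empty one. -/
def spectralRank {n : ℕ} (v : Fin n → ℤ) (i : Fin n) : ℕ :=
  (Finset.univ.filter fun k => (k < i ∧ v i ≤ v k) ∨ (i < k ∧ v i < v k)).card

lemma kIndex_eq_spectralRank {n : ℕ} (v : Fin (n + 1) → ℤ) (i : Fin (n + 1)) :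
    kIndex v i = spectralRank v i := by
  rw [kIndex, spectralRank, Finset.filter_or, Finset.card_union_of_disjoint]
  exact Finset.disjoint_filter.2 fun k _ h h' => lt_asymm h.1 h'.1

lemma spectralRank_natVec_castSucc {n : ℕ} (v : Fin (n + 1) → ℤ) (i : Fin n) :
    spectralRank (natVec v) i.castSucc = spectralRank v i.succ := by
  simp only [spectralRank, Finset.card_filter]
  rw [Fin.sum_univ_castSucc, Fin.sum_univ_succ, add_comm]
  simp [natVec, Fin.tail, Fin.castSucc_lt_last, (Fin.castSucc_lt_last _).not_gt]

lemma spectralRank_natVec_last {n : ℕ} (v : Fin (n + 1) → ℤ) :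
    spectralRank (natVec v) (Fin.last n) = spectralRank v 0 := by
  simp only [spectralRank, Finset.card_filter]
  rw [Fin.sum_univ_castSucc, Fin.sum_univ_succ, add_comm]
  simp [natVec, Fin.tail, Fin.castSucc_lt_last, (Fin.castSucc_lt_last _).not_gt]

lemma spectralRank_snoc_zero_castSucc {n : ℕ} {w : Fin n → ℤ} (hw : 0 ≤ w) (i : Fin n) :
    spectralRank (Fin.snoc (α := fun _ => ℤ) w 0) i.castSucc = spectralRank w i := by
  simp only [spectralRank, Finset.card_filter]
  rw [Fin.sum_univ_castSucc]
  have hi : 0 ≤ w i := hw i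
  simp [hi.not_gt, (Fin.castSucc_lt_last _).not_gt]

lemma spectralRank_snoc_zero_last {n : ℕ} {w : Fin n → ℤ} (hw : 0 ≤ w) :
    spectralRank (Fin.snoc (α := fun _ => ℤ) w 0) (Fin.last n) = n := by
  rw [spectralRank, Finset.card_filter, Fin.sum_univ_castSucc]
  simp [show ∀ i, 0 ≤ w i from hw, Fin.castSucc_lt_last]

lemma spectralRank_swapEntries {n : ℕ} {v : Fin (n + 1) → ℤ} {i : Fin n}
    (h : v i.castSucc ≠ v i.succ) (j : Fin (n + 1)) :
    spectralRank (swapEntries i v) j = spectralRank v (Equiv.swap i.castSucc i.succ j) := by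
  refine Finset.card_equiv (Equiv.swap i.castSucc i.succ) fun k => ?_
  rw [Finset.mem_filter_univ, Finset.mem_filter_univ]
  simp only [swapEntries, Function.comp_apply, Equiv.swap_apply_def]
  have hi : i.castSucc.val + 1 = i.succ.val := by simp
  generalize i.castSucc = a at *
  generalize i.succ = b at *
  split_ifs <;> simp only [Fin.lt_def, Fin.ext_iff, ← ne_eq] at * <;> omega

lemma spectralRank_succ_of_eq {n : ℕ} {v : Fin (n + 1) → ℤ} {i : Fin n}
    (h : v i.castSucc = v i.succ) : spectralRank v i.succ = spectralRank v i.castSucc + 1 := by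
  rw [spectralRank, spectralRank, ← Finset.card_insert_of_notMem (a := i.castSucc) (by simp)]
  congr 1
  ext k
  have hi : i.castSucc.val + 1 = i.succ.val := by simp
  have hk : k = i.castSucc → v k = v i.castSucc := congrArg v
  have hk' : k = i.succ → v k = v i.succ := congrArg v
  simp only [Finset.mem_filter_univ, Finset.mem_insert]
  generalize i.castSucc = a at *
  generalize i.succ = b at *
  simp only [Fin.lt_def, Fin.ext_iff] at *
  omega

lemma spectralRank_add_one {n : ℕ} (v : Fin n → ℤ) (i : Fin n) :
    spectralRank (v + 1) i = spectralRank v i := by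
  simp [spectralRank]

variable {k : Type*} [Field k]

/-- The spectral point `v̄` over any field containing parameters `q` and `t`. -/
def spectralPoint (q t : k) {n : ℕ} (v : Fin n → ℤ) (i : Fin n) : k :=
  q ^ v i * t ^ (-(spectralRank v i : ℤ))

lemma barF_eq_spectralPoint {n : ℕ} (v : Fin (n + 1) → ℤ) : barF v = spectralPoint qF tF v := by
  funext i
  rw [barF, spectralPoint, kIndex_eq_spectralRank]

lemma map_spectralPoint {K : Type*} [Field K] (f : k →+* K) (q t : k) {n : ℕ} (v : Fin n → ℤ)
    (i : Fin n) : f (spectralPoint q t v i) = spectralPoint (f q) (f t) v i := by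
  simp only [spectralPoint, map_mul, map_zpow₀]

lemma barK_eq_spectralPoint {n : ℕ} (v : Fin (n + 1) → ℤ) : barK v = spectralPoint qK tK v := by
  funext i
  rw [barK, barF_eq_spectralPoint, map_spectralPoint, qK, tK]

/-- The map `z ↦ (z_2, …, z_N, g z_1)`. -/
def rotate {A : Type*} (g : A → A) {n : ℕ} (z : Fin (n + 1) → A) : Fin (n + 1) → A :=
  Fin.snoc (Fin.tail z) (g (z 0))

section SpectralPoint

variable {q t : k} {n : ℕ}

lemma spectralPoint_natVec (hq : q ≠ 0) (v : Fin (n + 1) → ℤ) :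
    spectralPoint q t (natVec v) = rotate (q * ·) (spectralPoint q t v) := by
  funext i
  cases i using Fin.lastCases with
  | last =>
    simp only [rotate, Fin.snoc_last, spectralPoint, spectralRank_natVec_last]
    simp [natVec, zpow_one_add₀ hq, add_comm (v 0), mul_assoc]
  | cast i =>
    simp only [rotate, Fin.snoc_castSucc, spectralPoint, spectralRank_natVec_castSucc, Fin.tail]
    simp [natVec, Fin.tail]

lemma spectralPoint_snoc_zero {w : Fin n → ℤ} (hw : 0 ≤ w) :
    spectralPoint q t (Fin.snoc (α := fun _ => ℤ) w 0) =
      Fin.snoc (α := fun _ => k) (spectralPoint q t w) (t ^ (-(n : ℤ))) := by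
  funext i
  cases i using Fin.lastCases with
  | last => simp [spectralPoint, spectralRank_snoc_zero_last hw]
  | cast i => simp [spectralPoint, spectralRank_snoc_zero_castSucc hw]

lemma spectralPoint_swapEntries {v : Fin (n + 1) → ℤ} {i : Fin n}
    (h : v i.castSucc ≠ v i.succ) :
    spectralPoint q t (swapEntries i v) =
      spectralPoint q t v ∘ Equiv.swap i.castSucc i.succ := by
  funext j
  rw [Function.comp_apply, spectralPoint, spectralPoint, spectralRank_swapEntries h, swapEntries,
    Function.comp_apply]

lemma spectralPoint_castSucc_of_eq (ht : t ≠ 0) {v : Fin (n + 1) → ℤ} {i : Fin n}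
    (h : v i.castSucc = v i.succ) :
    spectralPoint q t v i.castSucc = t * spectralPoint q t v i.succ := by
  simp only [spectralPoint, spectralRank_succ_of_eq h, h]
  rw [mul_left_comm, ← zpow_one_add₀ ht]
  push_cast
  ring_nf

lemma spectralPoint_add_one (hq : q ≠ 0) (v : Fin n → ℤ) (i : Fin n) :
    spectralPoint q t (v + 1) i = q * spectralPoint q t v i := by
  rw [spectralPoint, spectralPoint, spectralRank_add_one, Pi.add_apply, Pi.one_apply,
    zpow_add_one₀ hq, mul_assoc, mul_left_comm]

end SpectralPoint

/-- The parameters `q, t` are nonzero and no nontrivial power of `q` is a power of `t`; all the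
polynomial arguments need no more than this about the indeterminates. -/
structure GenericParams (q t : k) : Prop where
  q_ne_zero : q ≠ 0
  t_ne_zero : t ≠ 0
  eq_zero_of_zpow_eq : ∀ a b : ℤ, q ^ a = t ^ b → a = 0

namespace GenericParams

variable {q t : k} {n : ℕ} {v : Fin n → ℤ} {i j : Fin n}

lemma map (h : GenericParams q t) {K : Type*} [Field K] (f : k →+* K) :
    GenericParams (f q) (f t) where
  q_ne_zero := (map_ne_zero f).2 h.q_ne_zero
  t_ne_zero := (map_ne_zero f).2 h.t_ne_zero
  eq_zero_of_zpow_eq a b e := h.eq_zero_of_zpow_eq a b (f.injective (by simpa using e))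

lemma spectralPoint_ne_zero (h : GenericParams q t) : spectralPoint q t v i ≠ 0 :=
  mul_ne_zero (zpow_ne_zero _ h.q_ne_zero) (zpow_ne_zero _ h.t_ne_zero)

lemma eq_of_spectralPoint_eq_zpow_mul (h : GenericParams q t) {b : ℤ}
    (e : spectralPoint q t v i = t ^ b * spectralPoint q t v j) : v i = v j := by
  have hq := h.q_ne_zero
  have ht := h.t_ne_zero
  refine sub_eq_zero.1 (h.eq_zero_of_zpow_eq _ (b + spectralRank v i - spectralRank v j) ?_)
  simp only [spectralPoint, zpow_neg] at e
  rw [zpow_sub₀ hq, zpow_sub₀ ht, zpow_add₀ ht]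
  field_simp at e ⊢
  linear_combination e

lemma spectralPoint_ne_zpow (h : GenericParams q t) (hv : v i ≠ 0) (b : ℤ) :
    spectralPoint q t v i ≠ t ^ b := by
  intro e
  refine hv (h.eq_zero_of_zpow_eq (v i) (b + spectralRank v i) ?_)
  rw [zpow_add₀ h.t_ne_zero, ← e, spectralPoint, mul_assoc, ← zpow_add₀ h.t_ne_zero]
  simp

end GenericParams

lemma eq_of_qF_pow_mul_tF_pow_eq {a b c d : ℕ} (h : qF ^ a * tF ^ b = qF ^ c * tF ^ d) :
    a = c := by
  have hX : (X 0 ^ a * X 1 ^ b : MvPolynomial (Fin 2) ℚ) = X 0 ^ c * X 1 ^ d :=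
    IsFractionRing.injective _ FF (by simpa [qF, tF] using h)
  simp only [X_pow_eq_monomial, monomial_mul, mul_one] at hX
  simpa using DFunLike.congr_fun (monomial_left_injective one_ne_zero hX) 0

lemma genericParams_FF : GenericParams qF tF where
  q_ne_zero := qF_ne_zero
  t_ne_zero := tF_ne_zero
  eq_zero_of_zpow_eq a b h := by
    have hpow : qF ^ a.toNat * tF ^ (-b).toNat = qF ^ (-a).toNat * tF ^ b.toNat := by
      have ha : ((a.toNat : ℕ) : ℤ) = a + ((-a).toNat : ℕ) := by omega
      have hb : ((b.toNat : ℕ) : ℤ) = b + ((-b).toNat : ℕ) := by omega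
      simp only [← zpow_natCast]
      rw [ha, hb, zpow_add₀ qF_ne_zero, zpow_add₀ tF_ne_zero, h]
      ring
    have := eq_of_qF_pow_mul_tF_pow_eq hpow
    omega

lemma genericParams_KK : GenericParams qK tK :=
  genericParams_FF.map (algebraMap FF KK)

/-! ### The operator `Φ` on polynomials -/

section Rotation

variable {n : ℕ} {q t : k}

/-- The substitution `Δ : p(x_1, …, x_N) ↦ p(q⁻¹ x_N, x_1, …, x_{N-1})` on polynomials. -/
def rotateVars (q : k) : MvPolynomial (Fin (n + 1)) k →ₐ[k] MvPolynomial (Fin (n + 1)) k :=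
  aeval (Fin.cons (C q⁻¹ * X (Fin.last n)) fun i : Fin n => X i.castSucc)

/-- The substitution `p(x_1, …, x_N) ↦ p(x_2, …, x_N, q x_1)`, the inverse of `rotateVars q`. -/
def unrotateVars (q : k) : MvPolynomial (Fin (n + 1)) k →ₐ[k] MvPolynomial (Fin (n + 1)) k :=
  aeval (rotate (C q * ·) X)

lemma rotateVars_unrotateVars (hq : q ≠ 0) (p : MvPolynomial (Fin (n + 1)) k) :
    rotateVars q (unrotateVars q p) = p := by
  have : (rotateVars q).comp (unrotateVars q) = AlgHom.id k (MvPolynomial (Fin (n + 1)) k) := by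
    ext1 i
    cases i using Fin.lastCases with
    | last => simp [rotateVars, unrotateVars, rotate, ← mul_assoc, ← C_mul, algebraMap_eq, hq]
    | cast i => simp [rotateVars, unrotateVars, rotate, Fin.tail]
  exact DFunLike.congr_fun this p

lemma unrotateVars_rotateVars (hq : q ≠ 0) (p : MvPolynomial (Fin (n + 1)) k) :
    unrotateVars q (rotateVars q p) = p := by
  have : (unrotateVars q).comp (rotateVars q) = AlgHom.id k (MvPolynomial (Fin (n + 1)) k) := by
    ext1 i
    cases i using Fin.cases with
    | zero => simp [rotateVars, unrotateVars, rotate, ← mul_assoc, ← C_mul, algebraMap_eq, hq]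
    | succ i => simp [rotateVars, unrotateVars, rotate, Fin.tail]
  exact DFunLike.congr_fun this p

lemma totalDegree_rotateVars_le (p : MvPolynomial (Fin (n + 1)) k) :
    (rotateVars q p).totalDegree ≤ p.totalDegree := by
  refine totalDegree_aeval_le _ (fun i => ?_) p
  cases i using Fin.cases with
  | zero => simpa using totalDegree_mul (C q⁻¹) (X (Fin.last n) : MvPolynomial (Fin (n + 1)) k)
  | succ i => simp

lemma totalDegree_unrotateVars_le (p : MvPolynomial (Fin (n + 1)) k) :
    (unrotateVars q p).totalDegree ≤ p.totalDegree := by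
  refine totalDegree_aeval_le _ (fun i => ?_) p
  cases i using Fin.lastCases with
  | last => simpa [rotate] using totalDegree_mul (C q) (X 0 : MvPolynomial (Fin (n + 1)) k)
  | cast i => simp [rotate, Fin.tail]

lemma totalDegree_rotateVars (hq : q ≠ 0) (p : MvPolynomial (Fin (n + 1)) k) :
    (rotateVars q p).totalDegree = p.totalDegree := by
  refine (totalDegree_rotateVars_le p).antisymm ?_
  conv_lhs => rw [← unrotateVars_rotateVars hq p]
  exact totalDegree_unrotateVars_le _

lemma rotateVars_ne_zero (hq : q ≠ 0) {p : MvPolynomial (Fin (n + 1)) k} (hp : p ≠ 0) :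
    rotateVars q p ≠ 0 := fun h =>
  hp (by rw [← unrotateVars_rotateVars hq p, h, map_zero])

lemma aeval_rotateVars {A : Type*} [CommRing A] [Algebra k A] (hq : q ≠ 0) (z : Fin (n + 1) → A)
    (p : MvPolynomial (Fin (n + 1)) k) :
    aeval (rotate (algebraMap k A q * ·) z) (rotateVars q p) = aeval z p := by
  have : (aeval (rotate (algebraMap k A q * ·) z)).comp (rotateVars q) = aeval (R := k) z := by
    ext i
    cases i using Fin.cases with
    | zero =>
      have hA : algebraMap k A q⁻¹ * algebraMap k A q = 1 := by
        rw [← map_mul, inv_mul_cancel₀ hq, map_one]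
      simp only [rotateVars, AlgHom.comp_apply, aeval_X, Fin.cons_zero, map_mul, aeval_C, rotate,
        Fin.snoc_last]
      rw [← mul_assoc, hA, one_mul]
    | succ i => simp [rotateVars, rotate, Fin.tail]
  exact DFunLike.congr_fun this p

lemma eval_rotateVars (hq : q ≠ 0) (z : Fin (n + 1) → k) (p : MvPolynomial (Fin (n + 1)) k) :
    eval (rotate (q * ·) z) (rotateVars q p) = eval z p := by
  simpa [aeval_eq_eval] using aeval_rotateVars hq z p

lemma rotateVars_monomial (u : Fin (n + 1) →₀ ℕ) (a : k) :
    rotateVars q (monomial u a) =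
      monomial (Finsupp.equivFunOnFinite.symm (rotate id u)) (q⁻¹ ^ u 0 * a) := by
  rw [monomial_eq, monomial_eq, Finsupp.prod_fintype _ _ (by simp),
    Finsupp.prod_fintype _ _ (by simp), map_mul, map_prod, Fin.prod_univ_succ,
    Fin.prod_univ_castSucc]
  simp only [rotateVars, aeval_C, algebraMap_eq, map_pow, aeval_X, Fin.cons_zero,
    Fin.cons_succ, rotate, Fin.tail, id_eq, Finsupp.equivFunOnFinite_symm_apply_apply,
    Fin.snoc_castSucc, Fin.snoc_last, mul_pow, C_mul]
  ring

lemma rotate_injective {A : Type*} {g : A → A} (hg : Function.Injective g) :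
    Function.Injective (rotate g (n := n)) := fun y z h => by
  obtain ⟨htail, hzero⟩ := Fin.snoc_injective2 h
  rw [← Fin.cons_self_tail y, ← Fin.cons_self_tail z, htail, hg hzero]

lemma coeff_rotateVars (p : MvPolynomial (Fin (n + 1)) k) (b : Fin (n + 1) → ℕ) :
    coeff (Finsupp.equivFunOnFinite.symm (rotate id b)) (rotateVars q p) =
      q⁻¹ ^ b 0 * coeff (Finsupp.equivFunOnFinite.symm b) p := by
  induction p using MvPolynomial.induction_on' with
  | add p p' hp hp' => rw [map_add, coeff_add, coeff_add, hp, hp', mul_add]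
  | monomial u a =>
    obtain ⟨u, rfl⟩ := Finsupp.equivFunOnFinite.symm.surjective u
    simp only [rotateVars_monomial, coeff_monomial, Finsupp.equivFunOnFinite_symm_apply_apply,
      Equiv.apply_eq_iff_eq, (rotate_injective Function.injective_id).eq_iff]
    by_cases hu : u = b <;> simp [hu]

/-- The operator `Φ = (x_N - t^(1-N)) Δ` on polynomials. -/
def phiPoly (q t : k) (p : MvPolynomial (Fin (n + 1)) k) : MvPolynomial (Fin (n + 1)) k :=
  (X (Fin.last n) - C (t ^ (-(n : ℤ)))) * rotateVars q p

lemma totalDegree_phiPoly (hq : q ≠ 0) {p : MvPolynomial (Fin (n + 1)) k} (hp : p ≠ 0) :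
    (phiPoly q t p).totalDegree = p.totalDegree + 1 := by
  rw [phiPoly, totalDegree_mul_of_isDomain (X_sub_C_ne_zero _ _) (rotateVars_ne_zero hq hp),
    totalDegree_X_sub_C, totalDegree_rotateVars hq, add_comm]

lemma totalDegree_phiPoly_le (p : MvPolynomial (Fin (n + 1)) k) :
    (phiPoly q t p).totalDegree ≤ p.totalDegree + 1 := by
  refine (totalDegree_mul _ _).trans ?_
  rw [totalDegree_X_sub_C, add_comm]
  exact Nat.add_le_add_right (totalDegree_rotateVars_le p) 1

lemma totalDegree_le_of_totalDegree_phiPoly_le (hq : q ≠ 0) {p : MvPolynomial (Fin (n + 1)) k}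
    {d : ℕ} (h : (phiPoly q t p).totalDegree ≤ d + 1) : p.totalDegree ≤ d := by
  rcases eq_or_ne p 0 with rfl | hp
  · simp
  · rw [totalDegree_phiPoly hq hp] at h
    omega

lemma coeff_phiPoly {p : MvPolynomial (Fin (n + 1)) k} {b : Fin (n + 1) → ℕ}
    (hp : p.totalDegree ≤ ∑ i, b i) :
    coeff (Finsupp.equivFunOnFinite.symm (rotate (· + 1) b)) (phiPoly q t p) =
      q⁻¹ ^ b 0 * coeff (Finsupp.equivFunOnFinite.symm b) p := by
  have hb : Finsupp.equivFunOnFinite.symm (rotate (· + 1) b) =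
      Finsupp.single (Fin.last n) 1 + Finsupp.equivFunOnFinite.symm (rotate id b) := by
    ext i
    cases i using Fin.lastCases <;> simp [rotate, add_comm]
  have htop : coeff (Finsupp.equivFunOnFinite.symm (rotate (· + 1) b)) (rotateVars q p) = 0 := by
    refine coeff_eq_zero_of_totalDegree_lt ((totalDegree_rotateVars_le p).trans_lt ?_)
    rw [← Finsupp.degree_apply, Finsupp.degree_eq_sum, Fin.sum_univ_castSucc]
    rw [Fin.sum_univ_succ] at hp
    simp only [Finsupp.equivFunOnFinite_symm_apply_apply, rotate, Fin.snoc_castSucc, Fin.snoc_last,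
      Fin.tail]
    omega
  rw [phiPoly, sub_mul, coeff_sub, coeff_C_mul, htop, hb, coeff_X_mul, coeff_rotateVars, mul_zero,
    sub_zero]

/-- The restriction of a polynomial to the hyperplane `x_N = c`. -/
def restrictLast (c : k) : MvPolynomial (Fin (n + 1)) k →ₐ[k] MvPolynomial (Fin n) k :=
  aeval (Fin.snoc (α := fun _ => MvPolynomial (Fin n) k) X (C c))

lemma eval_restrictLast (c : k) (p : MvPolynomial (Fin (n + 1)) k) (y : Fin n → k) :
    eval y (restrictLast c p) = eval (Fin.snoc (α := fun _ => k) y c) p := by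
  have : (aeval (R := k) y).comp (restrictLast c) = aeval (Fin.snoc (α := fun _ => k) y c) := by
    ext i
    cases i using Fin.lastCases <;> simp [restrictLast]
  simpa [aeval_eq_eval] using DFunLike.congr_fun this p

lemma totalDegree_restrictLast_le (c : k) (p : MvPolynomial (Fin (n + 1)) k) :
    (restrictLast c p).totalDegree ≤ p.totalDegree := by
  refine totalDegree_aeval_le _ (fun i => ?_) p
  cases i using Fin.lastCases <;> simp

lemma X_last_sub_C_dvd_sub_rename_restrictLast (c : k) (p : MvPolynomial (Fin (n + 1)) k) :
    X (Fin.last n) - C c ∣ p - rename Fin.castSucc (restrictLast c p) := by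
  refine dvd_algHom_sub_algHom (AlgHom.id k _) ((rename Fin.castSucc).comp (restrictLast c)) _
    (fun i => ?_) p
  cases i using Fin.lastCases <;> simp [restrictLast]

lemma exists_phiPoly_eq (hq : q ≠ 0) {p : MvPolynomial (Fin (n + 1)) k}
    (hp : restrictLast (t ^ (-(n : ℤ))) p = 0) : ∃ g, phiPoly q t g = p := by
  obtain ⟨g, hg⟩ := X_last_sub_C_dvd_sub_rename_restrictLast (t ^ (-(n : ℤ))) p
  refine ⟨unrotateVars q g, ?_⟩
  rw [phiPoly, rotateVars_unrotateVars hq, ← hg, hp, map_zero, sub_zero]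

lemma equivFunOnFinite_symm_snoc_zero (b : Fin n → ℕ) :
    Finsupp.equivFunOnFinite.symm (Fin.snoc (α := fun _ => ℕ) b 0) =
      Finsupp.mapDomain Fin.castSucc (Finsupp.equivFunOnFinite.symm b) := by
  ext i
  cases i using Fin.lastCases with
  | last =>
    rw [Finsupp.mapDomain_of_notMem_range]
    · simp
    · rintro ⟨j, hj⟩
      exact (Fin.castSucc_lt_last j).ne hj
  | cast i =>
    rw [Finsupp.mapDomain_apply (Fin.castSucc_injective n)]
    simp

lemma coeff_restrictLast (c : k) {p : MvPolynomial (Fin (n + 1)) k} {b : Fin n → ℕ}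
    (hp : p.totalDegree ≤ ∑ i, b i) :
    coeff (Finsupp.equivFunOnFinite.symm b) (restrictLast c p) =
      coeff (Finsupp.equivFunOnFinite.symm (Fin.snoc (α := fun _ => ℕ) b 0)) p := by
  set r := rename Fin.castSucc (restrictLast c p) with hr
  obtain ⟨g, hg⟩ := X_last_sub_C_dvd_sub_rename_restrictLast c p
  rw [← hr] at hg
  have hdiff :
      coeff (Finsupp.equivFunOnFinite.symm (Fin.snoc (α := fun _ => ℕ) b 0)) (p - r) = 0 := by
    rcases eq_or_ne g 0 with rfl | hg0
    · simp [hg]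
    have hdeg : (p - r).totalDegree ≤ ∑ i, b i := (totalDegree_sub p r).trans <| max_le hp <|
      (totalDegree_rename_le _ _).trans <| (totalDegree_restrictLast_le c p).trans hp
    rw [hg, totalDegree_mul_of_isDomain (X_sub_C_ne_zero _ _) hg0, totalDegree_X_sub_C] at hdeg
    rw [hg, sub_mul, coeff_sub, coeff_X_mul', if_neg (by simp), coeff_C_mul,
      coeff_eq_zero_of_totalDegree_lt, mul_zero, sub_zero]
    rw [← Finsupp.degree_apply, Finsupp.degree_eq_sum, Fin.sum_univ_castSucc]
    simp only [Finsupp.equivFunOnFinite_symm_apply_apply, Fin.snoc_castSucc, Fin.snoc_last]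
    omega
  rw [coeff_sub, sub_eq_zero] at hdiff
  rw [hdiff, equivFunOnFinite_symm_snoc_zero, hr,
    coeff_rename_mapDomain _ (Fin.castSucc_injective n)]

end Rotation

section Compositions

variable {n : ℕ}

lemma sum_natVec (v : Fin (n + 1) → ℤ) : ∑ i, natVec v i = ∑ i, v i + 1 := by
  rw [Fin.sum_univ_castSucc, Fin.sum_univ_succ]
  simp only [natVec, Fin.tail, Fin.snoc_castSucc, Fin.snoc_last]
  ring

lemma sum_sharpVec (v : Fin (n + 1) → ℤ) : ∑ i, sharpVec v i = ∑ i, v i - 1 := by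
  rw [← natVec_sharpVec v, sum_natVec, sharpVec_natVec, add_sub_cancel_right]

lemma natVec_nonneg {v : Fin (n + 1) → ℤ} (hv : 0 ≤ v) : 0 ≤ natVec v := fun i => by
  cases i using Fin.lastCases with
  | last => simpa [natVec] using add_nonneg (hv 0) zero_le_one
  | cast i => simpa [natVec, Fin.tail] using hv i.succ

lemma snoc_zero_nonneg {v : Fin n → ℤ} (hv : 0 ≤ v) :
    (0 : Fin (n + 1) → ℤ) ≤ Fin.snoc (α := fun _ => ℤ) v 0 := fun i => by
  cases i using Fin.lastCases with
  | last => simp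
  | cast i => simpa using hv i

lemma eq_snoc_zero_or_sharpVec_nonneg {w : Fin (n + 1) → ℤ} (hw : 0 ≤ w) :
    (∃ v, 0 ≤ v ∧ w = Fin.snoc (α := fun _ => ℤ) v 0) ∨ 0 ≤ sharpVec w := by
  rcases (hw (Fin.last n)).eq_or_lt with hlast | hlast
  · exact .inl ⟨Fin.init w, fun i => hw i.castSucc, by
      rw [show (0 : ℤ) = w (Fin.last n) from hlast, Fin.snoc_init_self]⟩
  · refine .inr fun i => ?_
    cases i using Fin.cases with
    | zero => exact Int.sub_nonneg.2 hlast
    | succ i => exact hw i.castSucc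

end Compositions

section Phi

variable {q t : k} {n : ℕ}

lemma eval_restrictLast_spectralPoint {v : Fin n → ℤ} (hv : 0 ≤ v)
    (p : MvPolynomial (Fin (n + 1)) k) :
    eval (spectralPoint q t v) (restrictLast (t ^ (-(n : ℤ))) p) =
      eval (spectralPoint q t (Fin.snoc (α := fun _ => ℤ) v 0)) p := by
  rw [eval_restrictLast, spectralPoint_snoc_zero hv]

lemma eval_phiPoly_natVec (hq : q ≠ 0) (v : Fin (n + 1) → ℤ) (p : MvPolynomial (Fin (n + 1)) k) :
    eval (spectralPoint q t (natVec v)) (phiPoly q t p) =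
      (spectralPoint q t (natVec v) (Fin.last n) - t ^ (-(n : ℤ))) *
        eval (spectralPoint q t v) p := by
  rw [phiPoly, map_mul, map_sub, eval_X, eval_C]
  congr 1
  rw [spectralPoint_natVec hq, eval_rotateVars hq]

lemma eval_eq_zero_of_eval_phiPoly_eq_zero (h : GenericParams q t) {v : Fin (n + 1) → ℤ}
    (hv : 0 ≤ v) {p : MvPolynomial (Fin (n + 1)) k}
    (hp : eval (spectralPoint q t (natVec v)) (phiPoly q t p) = 0) :
    eval (spectralPoint q t v) p = 0 := by
  rw [eval_phiPoly_natVec h.q_ne_zero] at hp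
  refine (mul_eq_zero.1 hp).resolve_left (sub_ne_zero.2 (h.spectralPoint_ne_zpow ?_ _))
  simpa [natVec] using (Int.lt_add_one_of_le (hv 0)).ne'

lemma eval_phiPoly_eq_zero (hq : q ≠ 0) {w : Fin (n + 1) → ℤ} (hw : 0 ≤ w)
    {p : MvPolynomial (Fin (n + 1)) k}
    (hp : 0 ≤ sharpVec w → eval (spectralPoint q t (sharpVec w)) p = 0) :
    eval (spectralPoint q t w) (phiPoly q t p) = 0 := by
  rcases eq_snoc_zero_or_sharpVec_nonneg hw with ⟨v, hv, rfl⟩ | hsharp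
  · simp [phiPoly, spectralPoint_snoc_zero hv]
  · rw [← natVec_sharpVec w, eval_phiPoly_natVec hq, hp hsharp, mul_zero]

end Phi

/-! ### Unisolvence of the interpolation problem -/

section Unisolvence

variable {q t : k}

lemma eq_zero_of_totalDegree_eq_zero {σ R : Type*} [CommRing R] {p : MvPolynomial σ R}
    (hp : p.totalDegree = 0) {z : σ → R} (hz : eval z p = 0) : p = 0 := by
  rw [totalDegree_eq_zero_iff_eq_C.1 hp, eval_C] at hz
  rw [totalDegree_eq_zero_iff_eq_C.1 hp, hz, C_0]

/-- The polynomial `p` vanishes at `w̄` for all compositions `w` with `|w| ≤ d`. -/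
def VanishesUpTo (q t : k) {n : ℕ} (d : ℤ) (p : MvPolynomial (Fin n) k) : Prop :=
  ∀ w : Fin n → ℤ, 0 ≤ w → ∑ i, w i ≤ d → eval (spectralPoint q t w) p = 0

/- Vanishing on the hyperplane `x_N = t^(1-N)`, where the last entry of the composition is zero,
makes `p` a multiple of `x_N - t^(1-N)`, hence of the form `Φ g` with `g` of smaller degree. -/
theorem eq_zero_of_vanishesUpTo (h : GenericParams q t) {n : ℕ} {p : MvPolynomial (Fin n) k}
    {d : ℕ} (hd : p.totalDegree ≤ d) (hp : VanishesUpTo q t d p) : p = 0 := by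
  induction n generalizing d with
  | zero =>
    exact eq_zero_of_totalDegree_eq_zero (by rw [eq_C_of_isEmpty p, totalDegree_C])
      (hp 0 le_rfl (by simp))
  | succ n ihn =>
    induction d generalizing p with
    | zero => exact eq_zero_of_totalDegree_eq_zero (Nat.le_zero.1 hd) (hp 0 le_rfl (by simp))
    | succ d ihd =>
      have hr : restrictLast (t ^ (-(n : ℤ))) p = 0 := by
        refine ihn ((totalDegree_restrictLast_le _ p).trans hd) fun v hv hvd => ?_
        rw [eval_restrictLast_spectralPoint hv]
        exact hp _ (snoc_zero_nonneg hv) (by simpa [Fin.sum_univ_castSucc] using hvd)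
      obtain ⟨g, rfl⟩ := exists_phiPoly_eq h.q_ne_zero hr
      have hg : g = 0 := by
        refine ihd (totalDegree_le_of_totalDegree_phiPoly_le h.q_ne_zero hd) fun v hv hvd => ?_
        refine eval_eq_zero_of_eval_phiPoly_eq_zero h hv (hp _ (natVec_nonneg hv) ?_)
        rw [sum_natVec]
        exact_mod_cast Int.add_le_add_right hvd 1
      rw [hg, phiPoly, map_zero, mul_zero]

/-- The polynomials of degree at most `|v|` vanishing at the spectral points of all compositions
`w ≠ v` with `|w| ≤ |v|`. For compositions `v` this is the line spanned by the interpolation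
polynomial. -/
def interpLine (q t : k) {n : ℕ} (v : Fin n → ℤ) : Submodule k (MvPolynomial (Fin n) k) where
  carrier := {p | p.totalDegree ≤ (∑ i, v i).toNat ∧
    ∀ w, 0 ≤ w → ∑ i, w i ≤ ∑ i, v i → w ≠ v → eval (spectralPoint q t w) p = 0}
  zero_mem' := ⟨by simp, by simp⟩
  add_mem' hp hp' := ⟨(totalDegree_add _ _).trans (max_le hp.1 hp'.1), fun w hw hs hne => by
    rw [map_add, hp.2 w hw hs hne, hp'.2 w hw hs hne, add_zero]⟩
  smul_mem' c p hp := ⟨(totalDegree_smul_le c p).trans hp.1, fun w hw hs hne => by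
    rw [smul_eval, hp.2 w hw hs hne, mul_zero]⟩

lemma mem_interpLine {n : ℕ} {v : Fin n → ℤ} {p : MvPolynomial (Fin n) k} :
    p ∈ interpLine q t v ↔ p.totalDegree ≤ (∑ i, v i).toNat ∧
      ∀ w, 0 ≤ w → ∑ i, w i ≤ ∑ i, v i → w ≠ v → eval (spectralPoint q t w) p = 0 :=
  Iff.rfl

lemma eq_zero_of_mem_interpLine (h : GenericParams q t) {n : ℕ} {v : Fin n → ℤ} (hv : 0 ≤ v)
    {p : MvPolynomial (Fin n) k} (hp : p ∈ interpLine q t v)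
    (hpv : eval (spectralPoint q t v) p = 0) : p = 0 := by
  refine eq_zero_of_vanishesUpTo h hp.1 fun w hw hs => ?_
  rcases eq_or_ne w v with rfl | hwv
  · exact hpv
  · exact hp.2 w hw (hs.trans_eq (Int.toNat_of_nonneg (Finset.sum_nonneg fun i _ => hv i))) hwv

lemma restrictLast_mem_interpLine {n : ℕ} {v : Fin n → ℤ} {p : MvPolynomial (Fin (n + 1)) k}
    (hp : p ∈ interpLine q t (Fin.snoc (α := fun _ => ℤ) v 0)) :
    restrictLast (t ^ (-(n : ℤ))) p ∈ interpLine q t v := by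
  have hsum (u : Fin n → ℤ) : ∑ i, Fin.snoc (α := fun _ => ℤ) u 0 i = ∑ i, u i := by
    simp [Fin.sum_univ_castSucc]
  rw [mem_interpLine, hsum] at hp
  refine ⟨(totalDegree_restrictLast_le _ p).trans hp.1, fun w hw hs hwv => ?_⟩
  rw [eval_restrictLast_spectralPoint hw]
  exact hp.2 _ (snoc_zero_nonneg hw) ((hsum w).trans_le hs) fun e => hwv (Fin.snoc_injective2 e).1

lemma restrictLast_eq_zero_of_mem_interpLine (h : GenericParams q t) {n : ℕ}
    {v : Fin (n + 1) → ℤ} (hv : 0 ≤ v) (hlast : v (Fin.last n) ≠ 0)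
    {p : MvPolynomial (Fin (n + 1)) k} (hp : p ∈ interpLine q t v) :
    restrictLast (t ^ (-(n : ℤ))) p = 0 := by
  refine eq_zero_of_vanishesUpTo h ((totalDegree_restrictLast_le _ p).trans hp.1) fun w hw hs => ?_
  rw [eval_restrictLast_spectralPoint hw]
  refine hp.2 _ (snoc_zero_nonneg hw) ?_ fun e => hlast (by rw [← e, Fin.snoc_last])
  rw [Int.toNat_of_nonneg (Finset.sum_nonneg fun i _ => hv i)] at hs
  simpa [Fin.sum_univ_castSucc] using hs

lemma mem_interpLine_of_phiPoly_mem (h : GenericParams q t) {n : ℕ} {v : Fin (n + 1) → ℤ}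
    (hv : 0 ≤ v) {p : MvPolynomial (Fin (n + 1)) k}
    (hp : phiPoly q t p ∈ interpLine q t (natVec v)) : p ∈ interpLine q t v := by
  have hpos : 0 ≤ ∑ i, v i := Finset.sum_nonneg fun i _ => hv i
  rw [mem_interpLine, sum_natVec, Int.toNat_add hpos zero_le_one] at hp
  refine ⟨totalDegree_le_of_totalDegree_phiPoly_le h.q_ne_zero hp.1, fun w hw hs hwv => ?_⟩
  refine eval_eq_zero_of_eval_phiPoly_eq_zero h hw (hp.2 _ (natVec_nonneg hw) ?_ fun e => hwv ?_)
  · rw [sum_natVec]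
    exact Int.add_le_add_right hs 1
  · rw [← sharpVec_natVec w, e, sharpVec_natVec]

lemma eq_snoc_zero_or_eq_rotate {n : ℕ} (α : Fin (n + 1) → ℕ) :
    (∃ b, α = Fin.snoc (α := fun _ => ℕ) b 0) ∨ ∃ b, α = rotate (· + 1) b := by
  rcases Nat.eq_zero_or_pos (α (Fin.last n)) with h | h
  · exact .inl ⟨Fin.init α, by rw [← h, Fin.snoc_init_self]⟩
  · refine .inr ⟨Fin.cons (α (Fin.last n) - 1) (Fin.init α), ?_⟩
    simp only [rotate, Fin.tail_cons, Fin.cons_zero, Nat.sub_add_cancel h, Fin.snoc_init_self]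

lemma natCast_snoc_zero {n : ℕ} (b : Fin n → ℕ) :
    (fun i => (Fin.snoc (α := fun _ => ℕ) b 0 i : ℤ)) =
      Fin.snoc (α := fun _ => ℤ) (fun i => (b i : ℤ)) 0 := by
  funext i
  cases i using Fin.lastCases <;> simp

lemma natCast_rotate_add_one {n : ℕ} (b : Fin (n + 1) → ℕ) :
    (fun i => ((rotate (A := ℕ) (· + 1) b i : ℕ) : ℤ)) = natVec fun i => (b i : ℤ) := by
  funext i
  cases i using Fin.lastCases <;> simp [rotate, natVec, Fin.tail]

lemma sum_rotate_add_one {n : ℕ} (b : Fin (n + 1) → ℕ) :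
    ∑ i, rotate (· + 1) b i = ∑ i, b i + 1 := by
  have := sum_natVec fun i => (b i : ℤ)
  rw [← natCast_rotate_add_one] at this
  beta_reduce at this
  exact_mod_cast this

theorem eq_zero_of_mem_interpLine_of_coeff_eq_zero (h : GenericParams q t) {n : ℕ}
    {α : Fin n → ℕ} {p : MvPolynomial (Fin n) k} (hp : p ∈ interpLine q t fun i => (α i : ℤ))
    (hc : coeff (Finsupp.equivFunOnFinite.symm α) p = 0) : p = 0 := by
  induction n with
  | zero =>
    ext m
    rw [Subsingleton.elim m (Finsupp.equivFunOnFinite.symm α), hc, coeff_zero]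
  | succ n ihn =>
    induction hd : ∑ i, α i using Nat.strong_induction_on generalizing α p with | _ d ihd
    have hα : (0 : Fin (n + 1) → ℤ) ≤ fun i => (α i : ℤ) := fun i => Int.natCast_nonneg _
    have hdeg : p.totalDegree ≤ ∑ i, α i := by simpa [← Nat.cast_sum] using hp.1
    rcases eq_snoc_zero_or_eq_rotate α with ⟨b, rfl⟩ | ⟨b, rfl⟩
    · refine eq_zero_of_mem_interpLine h hα hp ?_
      rw [natCast_snoc_zero] at hp ⊢
      rw [← eval_restrictLast_spectralPoint fun i => Int.natCast_nonneg _,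
        ihn (restrictLast_mem_interpLine hp), map_zero]
      rw [coeff_restrictLast _ (by simpa [Fin.sum_univ_castSucc] using hdeg), hc]
    · obtain ⟨g, rfl⟩ := exists_phiPoly_eq h.q_ne_zero <|
        restrictLast_eq_zero_of_mem_interpLine h hα (by simpa [rotate] using by omega) hp
      rw [sum_rotate_add_one] at hdeg hd
      rw [natCast_rotate_add_one] at hp
      have hg : g ∈ interpLine q t fun i => (b i : ℤ) :=
        mem_interpLine_of_phiPoly_mem h (fun i => Int.natCast_nonneg _) hp
      rw [coeff_phiPoly (totalDegree_le_of_totalDegree_phiPoly_le h.q_ne_zero hdeg)] at hc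
      have hg0 : g = 0 := ihd _ (by omega) hg ((mul_eq_zero.1 hc).resolve_left
        (pow_ne_zero _ (inv_ne_zero h.q_ne_zero))) rfl
      rw [hg0, phiPoly, map_zero, mul_zero]

lemma exists_totalDegree_le_eval_eq (h : GenericParams q t) {n : ℕ} (d : ℕ)
    (c : (Fin n → ℕ) → k) : ∃ p : MvPolynomial (Fin n) k, p.totalDegree ≤ d ∧
      ∀ β : Fin n → ℕ, ∑ i, β i ≤ d → eval (spectralPoint q t fun i => (β i : ℤ)) p = c β := by
  let S : Set (Fin n →₀ ℕ) := {m | (m.sum fun _ e => e) ≤ d}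
  have mem_S (β : Fin n → ℕ) : Finsupp.equivFunOnFinite.symm β ∈ S ↔ ∑ i, β i ≤ d := by
    simp [S, Finsupp.sum_fintype]
  have : Finite S := Finsupp.finite_of_degree_le d
  have := Fintype.ofFinite S
  let evalS : restrictTotalDegree (Fin n) k d →ₗ[k] S → k := LinearMap.pi fun m =>
    (aeval (spectralPoint q t fun i => (m.1 i : ℤ))).toLinearMap ∘ₗ Submodule.subtype _
  have evalS_injective : Function.Injective evalS := by
    refine (injective_iff_map_eq_zero evalS).2 fun p hp => Subtype.ext ?_
    refine eq_zero_of_vanishesUpTo h ((mem_restrictTotalDegree _ _ _).1 p.2) fun v hv hvd => ?_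
    lift v to Fin n → ℕ using hv
    beta_reduce at hvd ⊢
    exact congrFun hp ⟨_, (mem_S v).2 (by exact_mod_cast hvd)⟩
  have evalS_surjective : Function.Surjective evalS := by
    refine (LinearMap.injective_iff_surjective_of_finrank_eq_finrank ?_).1 evalS_injective
    rw [Module.finrank_fintype_fun_eq_card]
    exact Module.finrank_eq_card_basis (basisRestrictSupport k S)
  obtain ⟨p, hp⟩ := evalS_surjective fun m => c m.1
  exact ⟨p, (mem_restrictTotalDegree _ _ _).1 p.2, fun β hβ => congrFun hp ⟨_, (mem_S β).2 hβ⟩⟩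

lemma exists_mem_interpLine_coeff_eq_one (h : GenericParams q t) {n : ℕ} (α : Fin n → ℕ) :
    ∃ p ∈ interpLine q t fun i => (α i : ℤ), coeff (Finsupp.equivFunOnFinite.symm α) p = 1 := by
  obtain ⟨p, hdeg, hp⟩ := exists_totalDegree_le_eval_eq h (∑ i, α i) (Pi.single α 1)
  have hmem : p ∈ interpLine q t fun i => (α i : ℤ) := by
    refine ⟨by simpa [← Nat.cast_sum] using hdeg, fun w hw hs hne => ?_⟩
    lift w to Fin n → ℕ using hw
    beta_reduce at hs ⊢
    rw [hp w (by exact_mod_cast hs), Pi.single_eq_of_ne fun e => hne (by rw [e])]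
  have hp0 : p ≠ 0 := by
    rintro rfl
    simpa using hp α le_rfl
  have hc : coeff (Finsupp.equivFunOnFinite.symm α) p ≠ 0 := fun hc =>
    hp0 (eq_zero_of_mem_interpLine_of_coeff_eq_zero h hmem hc)
  exact ⟨_, Submodule.smul_mem _ (coeff (Finsupp.equivFunOnFinite.symm α) p)⁻¹ hmem, by
    rw [coeff_smul, smul_eq_mul, inv_mul_cancel₀ hc]⟩

end Unisolvence

lemma isInterpolation_iff {n : ℕ} (α : Fin (n + 1) → ℕ) (G : MvPolynomial (Fin (n + 1)) FF) :
    IsInterpolation α G ↔ (G ∈ interpLine qF tF fun i => (α i : ℤ)) ∧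
      coeff (Finsupp.equivFunOnFinite.symm α) G = 1 := by
  refine ⟨fun hG => ⟨⟨by simpa [← Nat.cast_sum] using hG.degree_le, fun w hw hs hne => ?_⟩,
    hG.coeff_eq_one⟩, fun ⟨hG, hc⟩ => ⟨by simpa [← Nat.cast_sum] using hG.1,
      fun β hs hne => ?_, hc⟩⟩
  · lift w to Fin (n + 1) → ℕ using hw
    beta_reduce at hs ⊢
    rw [← barF_eq_spectralPoint]
    exact hG.vanishing w (by exact_mod_cast hs) fun e => hne (by rw [e])
  · rw [barF_eq_spectralPoint]
    refine hG.2 _ (fun i => Int.natCast_nonneg _) (by beta_reduce; exact_mod_cast hs) fun e =>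
      hne ?_
    funext i
    exact_mod_cast congrFun e i

theorem existsUnique_isInterpolation {n : ℕ} (α : Fin (n + 1) → ℕ) :
    ∃! G, IsInterpolation α G := by
  obtain ⟨G, hG, hc⟩ := exists_mem_interpLine_coeff_eq_one genericParams_FF α
  refine ⟨G, (isInterpolation_iff α G).2 ⟨hG, hc⟩, fun G' hG' => ?_⟩
  obtain ⟨hG', hc'⟩ := (isInterpolation_iff α G').1 hG'
  refine sub_eq_zero.1 (eq_zero_of_mem_interpLine_of_coeff_eq_zero genericParams_FF
    (Submodule.sub_mem _ hG' hG) ?_)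
  rw [coeff_sub, hc, hc', sub_self]

lemma isInterpolation_interpG {n : ℕ} (α : Fin (n + 1) → ℕ) : IsInterpolation α (interpG α) :=
  Classical.epsilon_spec (existsUnique_isInterpolation α).exists

/-! ### Demazure–Lusztig operators on polynomials -/

section Hecke

variable {n : ℕ}

lemma X_sub_X_dvd_rename_swap_sub (i : Fin n) (p : MvPolynomial (Fin (n + 1)) k) :
    X i.castSucc - X i.succ ∣ rename (Equiv.swap i.castSucc i.succ) p - p := by
  refine dvd_algHom_sub_algHom (rename (Equiv.swap i.castSucc i.succ)) (AlgHom.id k _) _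
    (fun j => ?_) p
  rw [rename_X, AlgHom.id_apply]
  rw [Equiv.swap_apply_def]
  split_ifs with hcast hsucc
  · exact hcast ▸ (dvd_sub_comm.1 dvd_rfl)
  · exact hsucc ▸ dvd_rfl
  · exact sub_self (X j : MvPolynomial (Fin (n + 1)) k) ▸ dvd_zero _

/-- The divided difference `(s_i p - p) / (x_i - x_{i+1})`. -/
def dividedDifference (i : Fin n) (p : MvPolynomial (Fin (n + 1)) k) :
    MvPolynomial (Fin (n + 1)) k :=
  (X_sub_X_dvd_rename_swap_sub i p).choose

lemma mul_dividedDifference (i : Fin n) (p : MvPolynomial (Fin (n + 1)) k) :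
    (X i.castSucc - X i.succ) * dividedDifference i p =
      rename (Equiv.swap i.castSucc i.succ) p - p :=
  (X_sub_X_dvd_rename_swap_sub i p).choose_spec.symm

/-- The Demazure–Lusztig operator `H_i` on polynomials. -/
def heckePoly (t : k) (i : Fin n) (p : MvPolynomial (Fin (n + 1)) k) :
    MvPolynomial (Fin (n + 1)) k :=
  C t * p + (X i.castSucc - C t * X i.succ) * dividedDifference i p

lemma totalDegree_mul_dividedDifference_le {f : MvPolynomial (Fin (n + 1)) k}
    (hf : f.totalDegree ≤ 1) (i : Fin n) (p : MvPolynomial (Fin (n + 1)) k) :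
    (f * dividedDifference i p).totalDegree ≤ p.totalDegree := by
  rcases eq_or_ne (dividedDifference i p) 0 with h0 | h0
  · simp [h0]
  have hne : i.castSucc ≠ i.succ := Fin.castSucc_lt_succ.ne
  calc (f * dividedDifference i p).totalDegree
      ≤ 1 + (dividedDifference i p).totalDegree :=
        (totalDegree_mul _ _).trans (Nat.add_le_add_right hf _)
    _ = (rename (Equiv.swap i.castSucc i.succ) p - p).totalDegree := by
        rw [← mul_dividedDifference, totalDegree_mul_of_isDomain (X_sub_X_ne_zero hne) h0,
          totalDegree_X_sub_X hne]
    _ ≤ p.totalDegree :=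
        (totalDegree_sub _ _).trans (max_le (totalDegree_rename_le _ _) le_rfl)

lemma totalDegree_heckePoly_le (t : k) (i : Fin n) (p : MvPolynomial (Fin (n + 1)) k) :
    (heckePoly t i p).totalDegree ≤ p.totalDegree := by
  refine (totalDegree_add _ _).trans (max_le ?_ (totalDegree_mul_dividedDifference_le ?_ i p))
  · exact (totalDegree_mul _ _).trans (by simp)
  · refine (totalDegree_sub _ _).trans (max_le (totalDegree_X _).le ?_)
    exact (totalDegree_mul _ _).trans (by simp)

section Evaluation

variable {A : Type*} [CommRing A] [Algebra k A]

lemma mul_aeval_dividedDifference (i : Fin n) (p : MvPolynomial (Fin (n + 1)) k)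
    (z : Fin (n + 1) → A) :
    (z i.castSucc - z i.succ) * aeval z (dividedDifference i p) =
      aeval (z ∘ Equiv.swap i.castSucc i.succ) p - aeval z p := by
  simpa [aeval_rename] using congrArg (aeval z) (mul_dividedDifference i p)

lemma aeval_heckePoly (t : k) (i : Fin n) (p : MvPolynomial (Fin (n + 1)) k)
    (z : Fin (n + 1) → A) :
    aeval z (heckePoly t i p) = algebraMap k A t * aeval z p +
      (z i.castSucc - algebraMap k A t * z i.succ) * aeval z (dividedDifference i p) := by
  simp [heckePoly]

lemma aeval_heckePoly_of_eq_zero (t : k) {i : Fin n} (p : MvPolynomial (Fin (n + 1)) k)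
    {z : Fin (n + 1) → A} (hz : z i.castSucc = 0) :
    aeval z (heckePoly t i p) =
      algebraMap k A t * aeval (z ∘ Equiv.swap i.castSucc i.succ) p := by
  have h := mul_aeval_dividedDifference i p z
  rw [aeval_heckePoly]
  rw [hz] at h ⊢
  linear_combination algebraMap k A t * h

lemma eval_heckePoly_of_eq_mul {t : k} {i : Fin n} (p : MvPolynomial (Fin (n + 1)) k)
    {z : Fin (n + 1) → k} (hz : z i.castSucc = t * z i.succ) :
    eval z (heckePoly t i p) = t * eval z p := by
  simp [heckePoly, hz]

end Evaluation

/-- The coefficient `(v̄_i - t v̄_{i+1}) / (v̄_i - v̄_{i+1})` of the operator `Ĥ_i`. -/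
def heckeCoeff (q t : k) (i : Fin n) (v : Fin (n + 1) → ℤ) : k :=
  (spectralPoint q t v i.castSucc - t * spectralPoint q t v i.succ) /
    (spectralPoint q t v i.castSucc - spectralPoint q t v i.succ)

variable {q t : k} {i : Fin n} {v : Fin (n + 1) → ℤ}

lemma heckeCoeff_eq_zero (ht : t ≠ 0) (hv : v i.castSucc = v i.succ) :
    heckeCoeff q t i v = 0 := by
  rw [heckeCoeff, spectralPoint_castSucc_of_eq ht hv, sub_self, zero_div]

lemma spectralPoint_castSucc_sub_ne_zero (h : GenericParams q t) (hv : v i.castSucc ≠ v i.succ) :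
    spectralPoint q t v i.castSucc - spectralPoint q t v i.succ ≠ 0 := fun e =>
  hv (h.eq_of_spectralPoint_eq_zpow_mul (b := 0) (by rw [zpow_zero, one_mul, sub_eq_zero.1 e]))

lemma heckeCoeff_ne_zero (h : GenericParams q t) (hv : v i.castSucc ≠ v i.succ) :
    heckeCoeff q t i v ≠ 0 :=
  div_ne_zero
    (fun e => hv (h.eq_of_spectralPoint_eq_zpow_mul (b := 1) (by rw [zpow_one, sub_eq_zero.1 e])))
    (spectralPoint_castSucc_sub_ne_zero h hv)

lemma eval_heckePoly (h : GenericParams q t) (i : Fin n) (p : MvPolynomial (Fin (n + 1)) k)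
    (v : Fin (n + 1) → ℤ) :
    eval (spectralPoint q t v) (heckePoly t i p) =
      t * eval (spectralPoint q t v) p + heckeCoeff q t i v *
        (eval (spectralPoint q t (swapEntries i v)) p - eval (spectralPoint q t v) p) := by
  by_cases hv : v i.castSucc = v i.succ
  · rw [eval_heckePoly_of_eq_mul p (spectralPoint_castSucc_of_eq h.t_ne_zero hv),
      heckeCoeff_eq_zero h.t_ne_zero hv, zero_mul, add_zero]
  · have hne := spectralPoint_castSucc_sub_ne_zero h hv
    have hdd := mul_aeval_dividedDifference i p (spectralPoint q t v)
    have hH := aeval_heckePoly t i p (spectralPoint q t v)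
    simp only [aeval_eq_eval, Algebra.algebraMap_self, RingHom.id_apply] at hdd hH
    rw [spectralPoint_swapEntries hv, hH, ← hdd, heckeCoeff]
    field_simp

lemma sum_swapEntries (i : Fin n) (v : Fin (n + 1) → ℤ) :
    ∑ j, swapEntries i v j = ∑ j, v j :=
  Equiv.sum_comp (Equiv.swap i.castSucc i.succ) v

lemma swapEntries_swapEntries (i : Fin n) (v : Fin (n + 1) → ℤ) :
    swapEntries i (swapEntries i v) = v := by
  funext j
  simp [swapEntries]

lemma swapEntries_nonneg (hv : 0 ≤ v) : 0 ≤ swapEntries i v := fun _ => hv _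

theorem heckePoly_sub_mem_interpLine (h : GenericParams q t) (i : Fin n)
    {p : MvPolynomial (Fin (n + 1)) k} (hp : p ∈ interpLine q t v) :
    heckePoly t i p - (t - heckeCoeff q t i v) • p ∈ interpLine q t (swapEntries i v) := by
  rw [mem_interpLine, sum_swapEntries]
  refine ⟨((totalDegree_sub _ _).trans (max_le (totalDegree_heckePoly_le t i p)
    (totalDegree_smul_le _ p))).trans hp.1, fun w hw hs hne => ?_⟩
  have hswap : eval (spectralPoint q t (swapEntries i w)) p = 0 := by
    refine hp.2 _ (swapEntries_nonneg hw) (by rwa [sum_swapEntries]) fun e => hne ?_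
    rw [← e, swapEntries_swapEntries]
  rw [map_sub, smul_eval, eval_heckePoly h, hswap]
  rcases eq_or_ne w v with rfl | hwv
  · ring
  · rw [hp.2 w hw hs hwv]
    ring

theorem phiPoly_mem_interpLine (hq : q ≠ 0) (hv : 0 ≤ v) {p : MvPolynomial (Fin (n + 1)) k}
    (hp : p ∈ interpLine q t v) : phiPoly q t p ∈ interpLine q t (natVec v) := by
  have hpos : 0 ≤ ∑ i, v i := Finset.sum_nonneg fun i _ => hv i
  rw [mem_interpLine, sum_natVec, Int.toNat_add hpos zero_le_one]
  refine ⟨(totalDegree_phiPoly_le p).trans (Nat.add_le_add_right hp.1 1),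
    fun w hw hs hne => eval_phiPoly_eq_zero hq hw fun hsharp => hp.2 _ hsharp ?_ fun e => hne ?_⟩
  · rw [sum_sharpVec]
    omega
  · rw [← e, natVec_sharpVec]

namespace VanishesUpTo

variable {d : ℤ} {p : MvPolynomial (Fin (n + 1)) k}

lemma of_mem_interpLine (hp : p ∈ interpLine q t v) : VanishesUpTo q t (∑ i, v i - 1) p :=
  fun w hw hs => hp.2 w hw (by omega) fun e => by subst e; omega

lemma heckePoly (h : GenericParams q t) (hp : VanishesUpTo q t d p) (i : Fin n) :
    VanishesUpTo q t d (heckePoly t i p) := fun w hw hs => by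
  rw [eval_heckePoly h, hp w hw hs,
    hp (swapEntries i w) (swapEntries_nonneg hw) (by rwa [sum_swapEntries])]
  ring

lemma phiPoly (hq : q ≠ 0) (hp : VanishesUpTo q t d p) :
    VanishesUpTo q t (d + 1) (phiPoly q t p) := fun w hw hs =>
  eval_phiPoly_eq_zero hq hw fun hsharp => hp _ hsharp (by rw [sum_sharpVec]; omega)

lemma foldr_heckePoly (h : GenericParams q t) (hp : VanishesUpTo q t d p) (l : List (Fin n)) :
    VanishesUpTo q t d (l.foldr (InterpolationMacdonald.heckePoly t) p) := by
  induction l with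
  | nil => exact hp
  | cons i l ih => exact ih.heckePoly h i

end VanishesUpTo

lemma totalDegree_foldr_heckePoly_le (t : k) (l : List (Fin n))
    (p : MvPolynomial (Fin (n + 1)) k) :
    (l.foldr (heckePoly t) p).totalDegree ≤ p.totalDegree := by
  induction l with
  | nil => exact le_rfl
  | cons i l ih => exact (totalDegree_heckePoly_le t i _).trans ih

lemma eval_foldr_heckePoly {z : Fin (n + 1) → k}
    (hz : ∀ i : Fin n, z i.castSucc = t * z i.succ) (l : List (Fin n))
    (p : MvPolynomial (Fin (n + 1)) k) :
    eval z (l.foldr (heckePoly t) p) = t ^ l.length * eval z p := by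
  induction l with
  | nil => simp
  | cons i l ih =>
    rw [List.foldr_cons, eval_heckePoly_of_eq_mul _ (hz i), ih, List.length_cons, pow_succ',
      mul_assoc]

end Hecke

/-! ### Cherednik operators on polynomials -/

section IndexLists

variable {n : ℕ}

lemma filter_le_finRange (i : Fin n) :
    (List.finRange n).filter (fun j => i ≤ j) = i :: (List.finRange n).filter (fun j => i < j) := by
  induction n with
  | zero => exact i.elim0
  | succ n ih =>
    rw [List.finRange_succ]
    cases i using Fin.cases with
    | zero => simp [List.filter_map, Function.comp_def]
    | succ i => simp [List.filter_map, Function.comp_def, ih]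

lemma filter_finRange_le (i : Fin n) :
    (List.finRange n).filter (fun j => j ≤ i) =
      (List.finRange n).filter (fun j => j < i) ++ [i] := by
  induction n with
  | zero => exact i.elim0
  | succ n ih =>
    rw [List.finRange_succ]
    cases i using Fin.cases with
    | zero => simp [List.filter_map, Function.comp_def]
    | succ i => simp [List.filter_map, Function.comp_def, ih]

/-- The indices `j, j + 1, …, N - 1` of the factors of `H_j ⋯ H_{N-1}`. -/
def indicesFrom (j : Fin (n + 1)) : List (Fin n) :=
  (List.finRange n).filter fun i => j ≤ i.castSucc

/-- The indices `1, 2, …, j - 1` of the factors of `H_1 ⋯ H_{j-1}`. -/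
def indicesUpTo (j : Fin (n + 1)) : List (Fin n) :=
  (List.finRange n).filter fun i => i.castSucc < j

lemma indicesFrom_zero : indicesFrom (0 : Fin (n + 1)) = List.finRange n := by
  simp [indicesFrom]

lemma indicesFrom_last : indicesFrom (Fin.last n) = [] := by
  simp [indicesFrom]

lemma indicesFrom_castSucc (i : Fin n) :
    indicesFrom i.castSucc = i :: indicesFrom i.succ := by
  simp only [indicesFrom, Fin.castSucc_le_castSucc_iff, Fin.succ_le_castSucc_iff,
    filter_le_finRange]

lemma indicesUpTo_zero : indicesUpTo (0 : Fin (n + 1)) = [] := by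
  simp [indicesUpTo]

lemma indicesUpTo_succ (i : Fin n) :
    indicesUpTo i.succ = indicesUpTo i.castSucc ++ [i] := by
  simp only [indicesUpTo, Fin.castSucc_lt_castSucc_iff, Fin.castSucc_lt_succ_iff,
    filter_finRange_le]

lemma length_indicesUpTo_add_length_indicesFrom (j : Fin (n + 1)) :
    (indicesUpTo j).length + (indicesFrom j).length = n := by
  have := List.length_eq_length_filter_add (l := List.finRange n) fun i => i.castSucc < j
  simpa [indicesFrom, indicesUpTo, ← decide_not] using this.symm

end IndexLists

section Cherednik

variable {n : ℕ}

lemma insertNth_castSucc_comp_swap {A : Type*} (i : Fin n) (a : A) (y : Fin n → A) :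
    Fin.insertNth (α := fun _ => A) i.castSucc a y ∘ Equiv.swap i.castSucc i.succ =
      Fin.insertNth (α := fun _ => A) i.succ a y := by
  have hswap (l : Fin n) :
      Equiv.swap i.castSucc i.succ (i.succ.succAbove l) = i.castSucc.succAbove l := by
    simp only [Equiv.swap_apply_def, Fin.succAbove, Fin.ext_iff, Fin.lt_def]
    grind
  rw [Fin.eq_insertNth_iff]
  refine ⟨by simp, funext fun l => ?_⟩
  rw [Fin.removeNth, Function.comp_apply, hswap, Fin.insertNth_apply_succAbove]

section Hyperplane

variable {A : Type*} [CommRing A] [Algebra k A]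

lemma aeval_foldr_indicesFrom (t : k) (j : Fin (n + 1)) (p : MvPolynomial (Fin (n + 1)) k)
    (y : Fin n → A) :
    aeval (Fin.insertNth (α := fun _ => A) j 0 y) ((indicesFrom j).foldr (heckePoly t) p) =
      algebraMap k A t ^ (indicesFrom j).length *
        aeval (Fin.snoc (α := fun _ => A) y 0) p := by
  induction j using Fin.reverseInduction with
  | last => simp [indicesFrom_last, Fin.insertNth_last']
  | cast i ih =>
    rw [indicesFrom_castSucc, List.foldr_cons,
      aeval_heckePoly_of_eq_zero _ _ (Fin.insertNth_apply_same _ _ _),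
      insertNth_castSucc_comp_swap, ih, List.length_cons, pow_succ', mul_assoc]

lemma aeval_foldr_indicesUpTo (t : k) (j : Fin (n + 1)) (p : MvPolynomial (Fin (n + 1)) k)
    (y : Fin n → A) :
    aeval (Fin.cons (α := fun _ => A) 0 y) ((indicesUpTo j).foldr (heckePoly t) p) =
      algebraMap k A t ^ (indicesUpTo j).length *
        aeval (Fin.insertNth (α := fun _ => A) j 0 y) p := by
  induction j using Fin.induction generalizing p with
  | zero => simp [indicesUpTo_zero, Fin.insertNth_zero']
  | succ i ih =>
    rw [indicesUpTo_succ, List.foldr_append, ih, List.foldr_cons, List.foldr_nil,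
      aeval_heckePoly_of_eq_zero _ _ (Fin.insertNth_apply_same _ _ _),
      insertNth_castSucc_comp_swap, List.length_append, List.length_singleton, pow_succ, mul_assoc]

lemma aeval_phiPoly_snoc_zero {q : k} (hq : q ≠ 0) (t : k) (p : MvPolynomial (Fin (n + 1)) k)
    (y : Fin n → A) :
    aeval (Fin.snoc (α := fun _ => A) y 0) (phiPoly q t p) =
      -(algebraMap k A (t ^ n)⁻¹ * aeval (Fin.cons (α := fun _ => A) 0 y) p) := by
  have hrot := aeval_rotateVars hq (Fin.cons (α := fun _ => A) 0 y) p
  simp only [rotate, Fin.tail_cons, Fin.cons_zero, mul_zero] at hrot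
  rw [phiPoly, map_mul, hrot]
  simp

end Hyperplane

lemma X_dvd_sub_rename_insertNth (j : Fin (n + 1)) (p : MvPolynomial (Fin (n + 1)) k) :
    X j ∣ p - aeval (Fin.insertNth (α := fun _ => MvPolynomial (Fin (n + 1)) k) j 0
      fun i => X (j.succAbove i)) p := by
  refine dvd_algHom_sub_algHom (AlgHom.id k _) (aeval _) _ (fun i => ?_) p
  cases i using Fin.succAboveCases j <;> simp

/-- The operator `H_j ⋯ H_{N-1} Φ H_1 ⋯ H_{j-1}` on polynomials, so that
`Ξ_j p = x_j⁻¹ (p + cherednikPoly q t j p)`. -/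
def cherednikPoly (q t : k) (j : Fin (n + 1)) (p : MvPolynomial (Fin (n + 1)) k) :
    MvPolynomial (Fin (n + 1)) k :=
  (indicesFrom j).foldr (heckePoly t) (phiPoly q t ((indicesUpTo j).foldr (heckePoly t) p))

variable {q t : k}

lemma totalDegree_cherednikPoly_le (j : Fin (n + 1)) (p : MvPolynomial (Fin (n + 1)) k) :
    (cherednikPoly q t j p).totalDegree ≤ p.totalDegree + 1 :=
  (totalDegree_foldr_heckePoly_le t _ _).trans <| (totalDegree_phiPoly_le _).trans <|
    Nat.add_le_add_right (totalDegree_foldr_heckePoly_le t _ p) 1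

lemma VanishesUpTo.cherednikPoly (h : GenericParams q t) {d : ℤ}
    {p : MvPolynomial (Fin (n + 1)) k} (hp : VanishesUpTo q t d p) (j : Fin (n + 1)) :
    VanishesUpTo q t (d + 1) (cherednikPoly q t j p) :=
  ((hp.foldr_heckePoly h _).phiPoly h.q_ne_zero).foldr_heckePoly h _

/- On the hyperplane `x_j = 0` each `H_i` only moves the zero coordinate and multiplies by `t`,
while `Φ` multiplies by `-t^(1-N)`: altogether `p` is multiplied by `-1`. -/
lemma X_dvd_add_cherednikPoly (hq : q ≠ 0) (ht : t ≠ 0) (j : Fin (n + 1))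
    (p : MvPolynomial (Fin (n + 1)) k) : X j ∣ p + cherednikPoly q t j p := by
  have hzero (y : Fin n → MvPolynomial (Fin (n + 1)) k) :
      aeval (Fin.insertNth (α := fun _ => MvPolynomial (Fin (n + 1)) k) j 0 y)
        (p + cherednikPoly q t j p) = 0 := by
    have hpow : C t ^ (indicesFrom j).length * C (t ^ n)⁻¹ * C t ^ (indicesUpTo j).length =
        (1 : MvPolynomial (Fin (n + 1)) k) := by
      rw [mul_right_comm, ← pow_add, Nat.add_comm (indicesFrom j).length,
        length_indicesUpTo_add_length_indicesFrom, ← C_pow, ← C_mul,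
        mul_inv_cancel₀ (pow_ne_zero n ht), C_1]
    rw [map_add, cherednikPoly, aeval_foldr_indicesFrom, aeval_phiPoly_snoc_zero hq,
      aeval_foldr_indicesUpTo, algebraMap_eq]
    linear_combination -aeval (Fin.insertNth j 0 y) p * hpow
  simpa only [hzero, sub_zero] using X_dvd_sub_rename_insertNth j (p + cherednikPoly q t j p)

theorem add_cherednikPoly_of_mem_interpLine (h : GenericParams q t) {v : Fin (n + 1) → ℤ}
    (hv : 0 ≤ v) {p : MvPolynomial (Fin (n + 1)) k} (hp : p ∈ interpLine q t v)
    (j : Fin (n + 1)) :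
    p + cherednikPoly q t j p = X j * ((spectralPoint q t v j)⁻¹ • p) := by
  obtain ⟨g, hg⟩ := X_dvd_add_cherednikPoly h.q_ne_zero h.t_ne_zero j p
  have hdeg : g.totalDegree ≤ p.totalDegree := by
    rcases eq_or_ne g 0 with rfl | hg0
    · simp
    have hXg : (X j * g).totalDegree ≤ p.totalDegree + 1 := hg ▸ (totalDegree_add _ _).trans
      (max_le (Nat.le_succ _) (totalDegree_cherednikPoly_le j p))
    rw [totalDegree_mul_of_isDomain (X_ne_zero j) hg0, totalDegree_X] at hXg
    omega
  have heval (w : Fin (n + 1) → ℤ) (hw : 0 ≤ w) (hs : ∑ i, w i ≤ ∑ i, v i) :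
      eval (spectralPoint q t w) p = spectralPoint q t w j * eval (spectralPoint q t w) g := by
    have hvan := (VanishesUpTo.of_mem_interpLine hp).cherednikPoly h j w hw (by omega)
    simpa [hvan] using congrArg (eval (spectralPoint q t w)) hg
  have hgmem : g ∈ interpLine q t v := ⟨hdeg.trans hp.1, fun w hw hs hne =>
    (mul_eq_zero.1 ((heval w hw hs).symm.trans (hp.2 w hw hs hne))).resolve_left
      h.spectralPoint_ne_zero⟩
  rw [hg, ← sub_eq_zero.1 (eq_zero_of_mem_interpLine h hv (Submodule.sub_mem _ hgmem
    (Submodule.smul_mem _ (spectralPoint q t v j)⁻¹ hp)) ?_)]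
  rw [map_sub, smul_eval, heval v hv le_rfl, inv_mul_cancel_left₀ h.spectralPoint_ne_zero,
    sub_self]

end Cherednik

/-! ### Normalization at a generic point of the spectral line -/

section Normalization

variable {n : ℕ}

lemma pos_last_induction {P : (Fin (n + 1) → ℤ) → Prop}
    (swap : ∀ (i : Fin n) v, v i.castSucc ≠ v i.succ → P v → P (swapEntries i v))
    (last : ∀ v, 0 < v (Fin.last n) → P v) {v : Fin (n + 1) → ℤ} (j : Fin (n + 1))
    (hj : 0 < v j) : P v := by
  induction j using Fin.reverseInduction generalizing v with
  | last => exact last v hj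
  | cast i ih =>
    by_cases heq : v i.castSucc = v i.succ
    · exact ih (heq ▸ hj)
    · rw [← swapEntries_swapEntries i v]
      refine swap i _ ?_ (ih ?_)
      · simpa [swapEntries] using Ne.symm heq
      · simpa [swapEntries] using hj

lemma sharpVec_nonneg {v : Fin (n + 1) → ℤ} (hv : 0 ≤ v) (hlast : 0 < v (Fin.last n)) :
    0 ≤ sharpVec v := fun i => by
  cases i using Fin.cases with
  | zero => exact Int.sub_nonneg_of_le hlast
  | succ i => simpa [sharpVec, Fin.init] using hv i.castSucc

lemma nonneg_induction {P : (Fin (n + 1) → ℤ) → Prop} (zero : P 0)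
    (swap : ∀ (i : Fin n) v, 0 ≤ v → v i.castSucc ≠ v i.succ → P v → P (swapEntries i v))
    (nat : ∀ v, 0 ≤ v → P v → P (natVec v)) {v : Fin (n + 1) → ℤ} (hv : 0 ≤ v) : P v := by
  obtain ⟨d, hd⟩ := Int.eq_ofNat_of_zero_le (Finset.sum_nonneg fun j (_ : j ∈ Finset.univ) => hv j)
  induction d generalizing v with
  | zero =>
    have hzero : v = 0 := funext fun j =>
      (Finset.sum_eq_zero_iff_of_nonneg fun j _ => hv j).1 hd j (Finset.mem_univ j)
    exact hzero ▸ zero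
  | succ d ih =>
    obtain ⟨j, -, hj⟩ := Finset.exists_lt_of_sum_lt (s := Finset.univ) (f := fun _ => (0 : ℤ))
      (g := v) (by rw [hd]; simp)
    refine pos_last_induction (P := fun v => 0 ≤ v → ∑ j, v j = ↑(d + 1) → P v)
      (fun i v hne ihv hv hd => ?_) (fun v hlast hv hd => ?_) j hj hv hd
    · exact swap i v (swapEntries_swapEntries i v ▸ swapEntries_nonneg hv) hne
        (ihv (swapEntries_swapEntries i v ▸ swapEntries_nonneg hv) (sum_swapEntries i v ▸ hd))
    · rw [← natVec_sharpVec v]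
      exact nat _ (sharpVec_nonneg hv hlast)
        (ih (sharpVec_nonneg hv hlast) (by rw [sum_sharpVec, hd]; simp))

/-- A point of the line spanned by `τ = (1, t⁻¹, …, t^(1-N))` whose first coordinate is not the
first coordinate of a spectral point of a composition; interpolation polynomials are normalized
at such points. -/
structure GenericPoint (q t : k) (z : Fin (n + 1) → k) : Prop where
  castSucc_eq : ∀ i : Fin n, z i.castSucc = t * z i.succ
  zero_ne : ∀ v : Fin (n + 1) → ℤ, 0 ≤ v → z 0 ≠ spectralPoint q t v 0

variable {q t : k} {z : Fin (n + 1) → k} {v : Fin (n + 1) → ℤ} {p : MvPolynomial (Fin (n + 1)) k}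

/-- The factor by which `Φ` multiplies the value at a point with first coordinate `a` of a
polynomial in the line attached to `v`. -/
def phiCoeff (q t a : k) (v : Fin (n + 1) → ℤ) : k :=
  t ^ (-(n : ℤ)) * (a * (spectralPoint q t v 0)⁻¹ - 1)

/- Evaluating the eigenvalue equation of the first Cherednik operator `H_1 ⋯ H_{N-1} Φ`; at `z`
each `H_i` is multiplication by `t`. -/
lemma eval_phiPoly_of_mem_interpLine (h : GenericParams q t)
    (hz : ∀ i : Fin n, z i.castSucc = t * z i.succ) (hv : 0 ≤ v) (hp : p ∈ interpLine q t v) :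
    eval z (phiPoly q t p) = phiCoeff q t (z 0) v * eval z p := by
  have heigen := congrArg (eval z) (add_cherednikPoly_of_mem_interpLine h hv hp 0)
  rw [cherednikPoly, indicesUpTo_zero, List.foldr_nil, indicesFrom_zero, map_add,
    eval_foldr_heckePoly hz, List.length_finRange, map_mul, eval_X, smul_eval] at heigen
  have htn : t ^ (-(n : ℤ)) * t ^ n = 1 := by
    rw [zpow_neg, zpow_natCast, inv_mul_cancel₀ (pow_ne_zero n h.t_ne_zero)]
  rw [phiCoeff]
  linear_combination t ^ (-(n : ℤ)) * heigen - eval z (phiPoly q t p) * htn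

lemma GenericPoint.phiCoeff_ne_zero (h : GenericParams q t) (hz : GenericPoint q t z)
    (hv : 0 ≤ v) : phiCoeff q t (z 0) v ≠ 0 := by
  refine mul_ne_zero (zpow_ne_zero _ h.t_ne_zero) fun e => hz.zero_ne v hv ?_
  exact (mul_inv_eq_one₀ h.spectralPoint_ne_zero).1 (sub_eq_zero.1 e)

lemma eval_heckePoly_sub (hz : ∀ i : Fin n, z i.castSucc = t * z i.succ) (i : Fin n) (c : k)
    (p : MvPolynomial (Fin (n + 1)) k) :
    eval z (heckePoly t i p - (t - c) • p) = c * eval z p := by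
  rw [map_sub, eval_heckePoly_of_eq_mul p (hz i), smul_eval]
  ring

lemma exists_mem_interpLine_eval_ne_zero (h : GenericParams q t) (hz : GenericPoint q t z)
    (hv : 0 ≤ v) : ∃ p ∈ interpLine q t v, eval z p ≠ 0 := by
  refine nonneg_induction (P := fun v => ∃ p ∈ interpLine q t v, eval z p ≠ 0) ?zero ?swap ?nat hv
  case zero =>
    refine ⟨1, ⟨by simp, fun w hw hs hne => absurd ?_ hne⟩, by simp⟩
    funext j
    exact (Finset.sum_eq_zero_iff_of_nonneg fun j _ => hw j).1
      (le_antisymm (by simpa using hs) (Finset.sum_nonneg fun j _ => hw j)) j (Finset.mem_univ j)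
  case swap =>
    rintro i v - hne ⟨p, hp, hpz⟩
    refine ⟨_, heckePoly_sub_mem_interpLine h i hp, ?_⟩
    rw [eval_heckePoly_sub hz.castSucc_eq]
    exact mul_ne_zero (heckeCoeff_ne_zero h hne) hpz
  case nat =>
    rintro v hv ⟨p, hp, hpz⟩
    refine ⟨_, phiPoly_mem_interpLine h.q_ne_zero hv hp, ?_⟩
    rw [eval_phiPoly_of_mem_interpLine h hz.castSucc_eq hv hp]
    exact mul_ne_zero (hz.phiCoeff_ne_zero h hv) hpz

/- Two members of the line are proportional, because the combination vanishing at `v̄` vanishes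
identically. -/
lemma eval_smul_eq_eval_smul (h : GenericParams q t) (hv : 0 ≤ v)
    {p r : MvPolynomial (Fin (n + 1)) k} (hp : p ∈ interpLine q t v) (hr : r ∈ interpLine q t v) :
    eval (spectralPoint q t v) r • p = eval (spectralPoint q t v) p • r := by
  refine sub_eq_zero.1 (eq_zero_of_mem_interpLine h hv
    (Submodule.sub_mem _ (Submodule.smul_mem _ _ hp) (Submodule.smul_mem _ _ hr)) ?_)
  rw [map_sub, smul_eval, smul_eval]
  ring

theorem eval_ne_zero_of_mem_interpLine (h : GenericParams q t) (hz : GenericPoint q t z)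
    (hv : 0 ≤ v) (hp : p ∈ interpLine q t v) (hp0 : p ≠ 0) : eval z p ≠ 0 := by
  intro hpz
  obtain ⟨r, hr, hrz⟩ := exists_mem_interpLine_eval_ne_zero h hz hv
  have hprop := congrArg (eval z) (eval_smul_eq_eval_smul h hv hp hr)
  rw [smul_eval, smul_eval, hpz, mul_zero] at hprop
  exact hp0 (eq_zero_of_mem_interpLine h hv hp ((mul_eq_zero.1 hprop.symm).resolve_right hrz))

lemma eq_eval_smul_of_mem_interpLine (h : GenericParams q t) (hz : GenericPoint q t z)
    (hv : 0 ≤ v) {p r : MvPolynomial (Fin (n + 1)) k} (hp : p ∈ interpLine q t v)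
    (hr : r ∈ interpLine q t v) (hrz : eval z r = 1) : p = eval z p • r := by
  by_contra hne
  refine eval_ne_zero_of_mem_interpLine h hz hv
    (Submodule.sub_mem _ hp (Submodule.smul_mem _ (eval z p) hr)) (sub_ne_zero.2 hne) ?_
  rw [map_sub, smul_eval, hrz, mul_one, sub_self]

end Normalization

/-! ### Normalized families -/

section Rotate

variable {A : Type*} {n : ℕ}

lemma iterate_rotate (g : A → A) (z : Fin (n + 1) → A) {l : ℕ} (hl : l ≤ n + 1)
    (i : Fin (n + 1)) : (rotate g)^[l] z i =
      if h : i + l < n + 1 then z ⟨i + l, h⟩ else g (z ⟨i + l - (n + 1), by omega⟩) := by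
  induction l generalizing i with
  | zero => rw [dif_pos (by simpa using i.is_le)]; rfl
  | succ l ih =>
    rw [Function.iterate_succ_apply', rotate]
    cases i using Fin.lastCases with
    | last =>
      rw [Fin.snoc_last, ih (by omega), dif_pos (by simp; omega), dif_neg (by simp)]
      congr 2
      ext
      simp
      omega
    | cast i =>
      rw [Fin.snoc_castSucc, Fin.tail, ih (by omega)]
      simp only [Fin.val_succ, Fin.val_castSucc, add_assoc, add_comm 1 l]

lemma iterate_rotate_apply_zero (g : A → A) (z : Fin (n + 1) → A) (i : Fin (n + 1)) :
    (rotate g)^[i] z 0 = z i := by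
  rw [iterate_rotate g z i.is_lt.le, dif_pos (by simpa using i.is_le)]
  congr 1
  ext
  simp

lemma iterate_rotate_card (g : A → A) (z : Fin (n + 1) → A) :
    (rotate g)^[n + 1] z = g ∘ z := by
  funext i
  rw [iterate_rotate g z le_rfl, dif_neg (by omega)]
  simp

lemma iterate_natVec_card (v : Fin (n + 1) → ℤ) : natVec^[n + 1] v = v + 1 :=
  iterate_rotate_card (· + 1) v

lemma iterate_natVec_nonneg {v : Fin (n + 1) → ℤ} (hv : 0 ≤ v) (l : ℕ) : 0 ≤ natVec^[l] v := by
  induction l with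
  | zero => exact hv
  | succ l ih => exact Function.iterate_succ_apply' natVec l v ▸ natVec_nonneg ih

end Rotate

section Coefficients

variable {n : ℕ} {q t : k}

lemma spectralPoint_iterate_natVec (hq : q ≠ 0) (v : Fin (n + 1) → ℤ) (l : ℕ) :
    spectralPoint q t (natVec^[l] v) = (rotate (q * ·))^[l] (spectralPoint q t v) :=
  Function.Semiconj.iterate_right (fun v => spectralPoint_natVec hq v) l v

/-- The product over `i` of `1 - a / v̄_i`: the factor by which the extension of `K` to all
integral vectors relates the degrees `v` and `v + (1, …, 1)`. -/
def shiftCoeff (q t a : k) (v : Fin (n + 1) → ℤ) : k := ∏ i, (1 - a * (spectralPoint q t v i)⁻¹)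

lemma shiftCoeff_mul_phiCoeff (hq : q ≠ 0) (a : k) (v : Fin (n + 1) → ℤ) :
    shiftCoeff q t a v * phiCoeff q t a (v + 1) =
      phiCoeff q t a v * shiftCoeff q t a (natVec v) := by
  rw [shiftCoeff, shiftCoeff, Fin.prod_univ_succ, Fin.prod_univ_castSucc, phiCoeff, phiCoeff,
    spectralPoint_natVec hq, spectralPoint_add_one hq]
  simp only [rotate, Fin.snoc_castSucc, Fin.snoc_last, Fin.tail]
  ring

lemma heckeCoeff_add_one (hq : q ≠ 0) (i : Fin n) (v : Fin (n + 1) → ℤ) :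
    heckeCoeff q t i (v + 1) = heckeCoeff q t i v := by
  rw [heckeCoeff, heckeCoeff, spectralPoint_add_one hq, spectralPoint_add_one hq,
    mul_left_comm t, ← mul_sub, ← mul_sub, mul_div_mul_left _ _ hq]

/- When `v_i = v_{i+1}`, the vector `s_i v` is `v` itself. -/
lemma shiftCoeff_swapEntries (a : k) (i : Fin n) (v : Fin (n + 1) → ℤ) :
    shiftCoeff q t a (swapEntries i v) = shiftCoeff q t a v := by
  by_cases h : v i.castSucc = v i.succ
  · rw [swapEntries, Equiv.comp_swap_eq_update, h, Function.update_eq_self, ← h,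
      Function.update_eq_self]
  · rw [shiftCoeff, spectralPoint_swapEntries h]
    exact Equiv.prod_comp (Equiv.swap i.castSucc i.succ) fun j =>
      1 - a * (spectralPoint q t v j)⁻¹

end Coefficients

/-- A choice, for each composition `v`, of the element with value `1` at `z` in the line attached
to `v`. -/
structure NormalizedFamily {n : ℕ} (q t : k) (z : Fin (n + 1) → k)
    (K : (Fin (n + 1) → ℤ) → MvPolynomial (Fin (n + 1)) k) : Prop where
  mem : ∀ v, 0 ≤ v → K v ∈ interpLine q t v
  eval_eq_one : ∀ v, 0 ≤ v → eval z (K v) = 1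

namespace NormalizedFamily

variable {n : ℕ} {q t : k} {z : Fin (n + 1) → k}
  {K : (Fin (n + 1) → ℤ) → MvPolynomial (Fin (n + 1)) k} {v : Fin (n + 1) → ℤ}

theorem heckePoly_eq (hK : NormalizedFamily q t z K) (h : GenericParams q t)
    (hz : GenericPoint q t z) (hv : 0 ≤ v) (i : Fin n) :
    heckePoly t i (K v) =
      t • K v + heckeCoeff q t i v • (K (swapEntries i v) - K v) := by
  have hswap := swapEntries_nonneg (i := i) hv
  have hmem := heckePoly_sub_mem_interpLine h i (hK.mem v hv)
  have heq := eq_eval_smul_of_mem_interpLine h hz hswap hmem (hK.mem _ hswap)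
    (hK.eval_eq_one _ hswap)
  rw [eval_heckePoly_sub hz.castSucc_eq, hK.eval_eq_one v hv, mul_one, sub_eq_iff_eq_add] at heq
  rw [heq]
  module

theorem phiPoly_eq (hK : NormalizedFamily q t z K) (h : GenericParams q t)
    (hz : GenericPoint q t z) (hv : 0 ≤ v) :
    phiPoly q t (K v) = phiCoeff q t (z 0) v • K (natVec v) := by
  have hnat := natVec_nonneg hv
  have heq := eq_eval_smul_of_mem_interpLine h hz hnat
    (phiPoly_mem_interpLine h.q_ne_zero hv (hK.mem v hv)) (hK.mem _ hnat) (hK.eval_eq_one _ hnat)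
  rwa [eval_phiPoly_of_mem_interpLine h hz.castSucc_eq hv (hK.mem v hv), hK.eval_eq_one v hv,
    mul_one] at heq

section Shift

variable {A : Type*} [CommRing A] [Algebra k A]

lemma aeval_rotate_natVec (hK : NormalizedFamily q t z K) (h : GenericParams q t)
    (hz : GenericPoint q t z) (hv : 0 ≤ v) (y : Fin (n + 1) → A) :
    algebraMap k A (1 - z 0 * (spectralPoint q t v 0)⁻¹) *
        aeval (rotate (algebraMap k A q * ·) y) (K (natVec v)) =
      (1 - algebraMap k A (q * t ^ n) * y 0) * aeval y (K v) := by
  have hphi := congrArg (aeval (rotate (algebraMap k A q * ·) y)) (hK.phiPoly_eq h hz hv)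
  have hlast : rotate (algebraMap k A q * ·) y (Fin.last n) = algebraMap k A q * y 0 :=
    Fin.snoc_last _ _
  rw [phiPoly, map_mul, aeval_rotateVars h.q_ne_zero, map_sub, aeval_X, aeval_C, hlast, map_smul,
    Algebra.smul_def, phiCoeff] at hphi
  have htn : algebraMap k A (t ^ n) * algebraMap k A (t ^ (-(n : ℤ))) = 1 := by
    rw [← map_mul, zpow_neg, zpow_natCast, mul_inv_cancel₀ (pow_ne_zero n h.t_ne_zero), map_one]
  set X := aeval (rotate (algebraMap k A q * ·) y) (K (natVec v))
  simp only [map_mul, map_sub, map_one] at hphi ⊢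
  linear_combination algebraMap k A (t ^ n) * hphi +
    (aeval y (K v) + (algebraMap k A (z 0) * algebraMap k A (spectralPoint q t v 0)⁻¹ - 1) * X) *
      htn

theorem aeval_add_one (hK : NormalizedFamily q t z K) (h : GenericParams q t)
    (hz : GenericPoint q t z) (hv : 0 ≤ v) (y : Fin (n + 1) → A) :
    algebraMap k A (shiftCoeff q t (z 0) v) * aeval (fun i => algebraMap k A q * y i) (K (v + 1)) =
      (∏ i, (1 - algebraMap k A (q * t ^ n) * y i)) * aeval y (K v) := by
  suffices hiter : ∀ l, algebraMap k A
        (∏ j ∈ Finset.range l, (1 - z 0 * (spectralPoint q t (natVec^[j] v) 0)⁻¹)) *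
      aeval ((rotate (algebraMap k A q * ·))^[l] y) (K (natVec^[l] v)) =
      (∏ j ∈ Finset.range l, (1 - algebraMap k A (q * t ^ n) *
        (rotate (algebraMap k A q * ·))^[j] y 0)) * aeval y (K v) by
    have hcard := hiter (n + 1)
    rw [iterate_natVec_card, iterate_rotate_card, ← Fin.prod_univ_eq_prod_range
      (fun j => 1 - z 0 * (spectralPoint q t (natVec^[j] v) 0)⁻¹), ← Fin.prod_univ_eq_prod_range
      (fun j => 1 - algebraMap k A (q * t ^ n) * (rotate (algebraMap k A q * ·))^[j] y 0)] at hcard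
    simp only [iterate_rotate_apply_zero, spectralPoint_iterate_natVec h.q_ne_zero] at hcard
    exact hcard
  intro l
  induction l with
  | zero => simp
  | succ l ih =>
    have hstep := hK.aeval_rotate_natVec h hz (iterate_natVec_nonneg hv l)
      ((rotate (algebraMap k A q * ·))^[l] y)
    rw [← Function.iterate_succ_apply' natVec, ← Function.iterate_succ_apply' (rotate _)] at hstep
    rw [Finset.prod_range_succ, Finset.prod_range_succ, map_mul]
    linear_combination algebraMap k A (∏ j ∈ Finset.range l,
        (1 - z 0 * (spectralPoint q t (natVec^[j] v) 0)⁻¹)) * hstep +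
      (1 - algebraMap k A (q * t ^ n) * (rotate (algebraMap k A q * ·))^[l] y 0) * ih

end Shift

end NormalizedFamily

/-! ### Normalized interpolation polynomials over `𝕂` -/

section Kint

variable {n : ℕ}

lemma aK_ne_algebraMap (x : FF) : aK ≠ algebraMap FF KK x := by
  rw [aK, ← RatFunc.algebraMap_X, RatFunc.algebraMap_eq_C, ← RatFunc.algebraMap_C]
  exact (RatFunc.algebraMap_injective FF).ne (Polynomial.X_ne_C x)

lemma aTau_zero : aTau n 0 = aK := by simp [aTau]

lemma genericPoint_aTau (n : ℕ) : GenericPoint qK tK (aTau n) where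
  castSucc_eq i := by
    simp only [aTau, Fin.val_castSucc, Fin.val_succ]
    rw [mul_left_comm, ← zpow_one_add₀ genericParams_KK.t_ne_zero]
    congr 2
    push_cast
    ring
  zero_ne v _ := by
    rw [aTau_zero, ← barK_eq_spectralPoint]
    exact aK_ne_algebraMap _

lemma interpGK_mem_interpLine (α : Fin (n + 1) → ℕ) :
    interpGK α ∈ interpLine qK tK fun i => (α i : ℤ) := by
  obtain ⟨hdeg, hvanish⟩ := ((isInterpolation_iff α _).1 (isInterpolation_interpG α)).1
  refine ⟨(Finset.sup_mono (support_map_subset _ _)).trans hdeg, fun w hw hs hne => ?_⟩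
  have hmap : spectralPoint qK tK w = algebraMap FF KK ∘ spectralPoint qF tF w :=
    funext fun i => (map_spectralPoint (algebraMap FF KK) qF tF w i).symm
  rw [interpGK, hmap, eval_map, ← eval₂_comp]
  exact (congrArg _ (hvanish w hw hs hne)).trans (map_zero _)

lemma interpGK_ne_zero (α : Fin (n + 1) → ℕ) : interpGK α ≠ 0 := fun h => by
  have hcoeff := congrArg (coeff (Finsupp.equivFunOnFinite.symm α)) h
  rw [interpGK, coeff_map, (isInterpolation_interpG α).coeff_eq_one, map_one, coeff_zero] at hcoeff
  exact one_ne_zero hcoeff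

theorem evalG_ne_zero (α : Fin (n + 1) → ℕ) : evalG α ≠ 0 :=
  eval_ne_zero_of_mem_interpLine genericParams_KK (genericPoint_aTau n) (fun i => by simp)
    (interpGK_mem_interpLine α) (interpGK_ne_zero α)

/-- The polynomial `K_v` for a composition `v`, regarded as an integral vector; negative entries
are truncated to `0`. -/
def Kint (v : Fin (n + 1) → ℤ) : KPoly n := Kpoly fun i => (v i).toNat

lemma normalizedFamily_Kint (n : ℕ) : NormalizedFamily qK tK (aTau n) Kint where
  mem v hv := by
    lift v to Fin (n + 1) → ℕ using hv
    simpa [Kint, Kpoly, C_mul'] using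
      Submodule.smul_mem _ (evalG v)⁻¹ (interpGK_mem_interpLine v)
  eval_eq_one v _ := by
    rw [Kint, Kpoly, map_mul, eval_C]
    exact inv_mul_cancel₀ (evalG_ne_zero _)

end Kint

/-! ### Extension to integral vectors by shifts -/

section Shift

variable {n : ℕ}

lemma algHom_ext_xvar {f g : KRat n →ₐ[KK] KRat n} (h : ∀ i, f (xvar n i) = g (xvar n i)) :
    f = g :=
  IsLocalization.algHom_ext (nonZeroDivisors (KPoly n)) (algHom_ext h)

lemma aeval_xvar (p : KPoly n) : aeval (xvar n) p = algebraMap (KPoly n) (KRat n) p :=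
  (aeval_algebraMap_apply (KRat n) X p).trans (by rw [aeval_X_left_apply])

/-- The automorphism `f(x) ↦ f(q x)` of `𝕂[x]`. -/
def scalePoly (n : ℕ) : KPoly n ≃ₐ[KK] KPoly n :=
  AlgEquiv.ofAlgHom (aeval fun i => C qK * X i) (aeval fun i => C qK⁻¹ * X i)
    (by
      ext1 i
      simp [← mul_assoc, ← C_mul, algebraMap_eq, qK_ne_zero])
    (by
      ext1 i
      simp [← mul_assoc, ← C_mul, algebraMap_eq, qK_ne_zero])

/-- The automorphism `f(x) ↦ f(q x)` of `𝕂(x)`. -/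
def scaleVars (n : ℕ) : KRat n ≃ₐ[KK] KRat n :=
  IsFractionRing.fieldEquivOfAlgEquiv KK (KRat n) (KRat n) (scalePoly n)

lemma scaleVars_xvar (i : Fin (n + 1)) :
    scaleVars n (xvar n i) = algebraMap KK (KRat n) qK * xvar n i := by
  rw [xvar, scaleVars, IsFractionRing.fieldEquivOfAlgEquiv_algebraMap, scalePoly,
    AlgEquiv.ofAlgHom_apply, aeval_X, map_mul, ← algebraMap_eq, ← IsScalarTower.algebraMap_apply]

lemma scaleVars_aeval (y : Fin (n + 1) → KRat n) (p : KPoly n) :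
    scaleVars n (aeval y p) = aeval (fun i => scaleVars n (y i)) p :=
  comp_aeval_apply y (scaleVars n).toAlgHom p

lemma scaleVars_algebraMap (p : KPoly n) :
    scaleVars n (algebraMap (KPoly n) (KRat n) p) =
      aeval (fun i => algebraMap KK (KRat n) qK * xvar n i) p := by
  rw [← aeval_xvar, scaleVars_aeval]
  simp only [scaleVars_xvar]

/-- The product of the denominators of `A_1(x; v)`. -/
def shiftDen (n : ℕ) : KRat n := ∏ i, (1 - algebraMap KK (KRat n) (qK * tK ^ n) * xvar n i)

lemma shiftDen_ne_zero (n : ℕ) : shiftDen n ≠ 0 := by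
  refine Finset.prod_ne_zero_iff.2 fun i _ h => ?_
  rw [xvar, IsScalarTower.algebraMap_apply KK (KPoly n) (KRat n), ← map_mul,
    ← map_one (algebraMap (KPoly n) (KRat n)), ← map_sub] at h
  have h0 := congrArg (eval fun _ => 0) ((IsFractionRing.to_map_eq_zero_iff).1 h)
  simp at h0

/-- The operator `f(x) ↦ f(q x) / ∏_i (1 - q t ^ (N - 1) x_i)`, which carries `K_{v + (1, …, 1)}`
to a multiple of `K_v`. -/
def shiftOp (n : ℕ) : Module.End KK (KRat n) := mulOp (shiftDen n)⁻¹ * (scaleVars n).toLinearMap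

lemma shiftOp_apply (f : KRat n) : shiftOp n f = (shiftDen n)⁻¹ * scaleVars n f := rfl

lemma algebraMap_Kint_eq_shiftOp {v : Fin (n + 1) → ℤ} (hv : 0 ≤ v) :
    algebraMap (KPoly n) (KRat n) (Kint v) =
      shiftCoeff qK tK aK v • shiftOp n (algebraMap (KPoly n) (KRat n) (Kint (v + 1))) := by
  have hshift := (normalizedFamily_Kint n).aeval_add_one genericParams_KK (genericPoint_aTau n) hv
    (xvar n)
  rw [aTau_zero, aeval_xvar, ← scaleVars_algebraMap, ← shiftDen] at hshift
  rw [shiftOp_apply, Algebra.smul_def, mul_left_comm, hshift,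
    inv_mul_cancel_left₀ (shiftDen_ne_zero n)]

lemma map_qPoch (σ : KRat n ≃ₐ[KK] KRat n) (y : KRat n) (m : ℕ) :
    σ (qPoch y m) = qPoch (σ y) m := by
  simp only [qPoch, map_prod, map_sub, map_one, map_mul, AlgEquiv.commutes]

lemma qPoch_succ (y : KRat n) (m : ℕ) :
    qPoch y (m + 1) = (1 - algebraMap KK (KRat n) (qK ^ m) * y) * qPoch y m := by
  rw [qPoch, Finset.prod_range_succ, ← qPoch, mul_comm]

lemma qPoch_succ' (y : KRat n) (m : ℕ) :
    qPoch y (m + 1) = (1 - y) * qPoch (algebraMap KK (KRat n) qK * y) m := by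
  rw [qPoch, Finset.prod_range_succ', pow_zero, map_one, one_mul, mul_comm, qPoch]
  simp only [pow_succ, map_mul, mul_assoc]

lemma factorA_succ (m : ℕ) (v : Fin (n + 1) → ℤ) :
    factorA (m + 1) v = shiftCoeff qK tK aK v •
      ((shiftDen n)⁻¹ * scaleVars n (factorA m (v + 1))) := by
  have hnum (i) : qK ^ (1 - ((m + 1 : ℕ) : ℤ)) * aK * (barK v i)⁻¹ =
      qK ^ (1 - (m : ℤ)) * aK * (barK (v + 1) i)⁻¹ := by
    rw [barK_eq_spectralPoint, barK_eq_spectralPoint, spectralPoint_add_one qK_ne_zero, mul_inv,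
      Nat.cast_succ, ← sub_sub, zpow_sub_one₀ qK_ne_zero]
    ring
  have hlast (i) : qK ^ m * (qK ^ (1 - (m : ℤ)) * aK * (barK (v + 1) i)⁻¹) =
      aK * (spectralPoint qK tK v i)⁻¹ := by
    rw [barK_eq_spectralPoint, spectralPoint_add_one qK_ne_zero, zpow_sub₀ qK_ne_zero, zpow_one,
      zpow_natCast]
    have hq := qK_ne_zero
    field_simp
  rw [factorA, factorA, Algebra.smul_def, shiftCoeff, shiftDen, map_prod, map_prod,
    ← Finset.prod_inv_distrib, ← Finset.prod_mul_distrib, ← Finset.prod_mul_distrib]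
  refine Finset.prod_congr rfl fun i _ => ?_
  rw [hnum, qPoch_succ, qPoch_succ', ← map_mul, hlast, map_div₀, map_qPoch, map_qPoch,
    map_mul (scaleVars n), AlgEquiv.commutes, AlgEquiv.commutes, scaleVars_xvar, map_sub, map_one,
    mul_left_comm (algebraMap KK (KRat n) qK), mul_div_mul_comm, div_eq_mul_inv (1 - _), mul_assoc]

lemma shiftedK_succ_eq_shiftOp (m : ℕ) (v : Fin (n + 1) → ℤ) :
    shiftedK (m + 1) v = shiftCoeff qK tK aK v • shiftOp n (shiftedK m (v + 1)) := by
  have hK : (fun i => (v i + (m + 1 : ℕ)).toNat) = fun i => ((v + 1) i + m).toNat := by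
    funext i
    rw [Nat.cast_succ, Pi.add_apply, Pi.one_apply, add_right_comm, add_assoc]
  rw [shiftedK, shiftedK, factorA_succ, hK, shiftOp_apply, map_mul, scaleVars_aeval]
  simp only [map_mul, scaleVars_xvar, AlgEquiv.commutes, pow_succ, mul_assoc, smul_mul_assoc]

lemma shiftedK_zero (v : Fin (n + 1) → ℤ) :
    shiftedK 0 v = algebraMap (KPoly n) (KRat n) (Kint v) := by
  simp [shiftedK, factorA, qPoch, ← aeval_xvar, Kint]

theorem shiftedK_succ {m : ℕ} {v : Fin (n + 1) → ℤ} (hv : ∀ i, 0 ≤ v i + m) :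
    shiftedK (m + 1) v = shiftedK m v := by
  induction m generalizing v with
  | zero =>
    rw [shiftedK_succ_eq_shiftOp, shiftedK_zero, shiftedK_zero,
      ← algebraMap_Kint_eq_shiftOp fun i => by simpa using hv i]
  | succ m ih =>
    rw [shiftedK_succ_eq_shiftOp, ih fun i => ?_, ← shiftedK_succ_eq_shiftOp]
    have := hv i
    simp only [Pi.add_apply, Pi.one_apply]
    omega

lemma minShift_le {v : Fin (n + 1) → ℤ} {m : ℕ} (h : ∀ i, 0 ≤ v i + m) : minShift v ≤ m :=
  Finset.sup_le fun i _ => by have := h i; omega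

lemma add_minShift_nonneg (v : Fin (n + 1) → ℤ) (i : Fin (n + 1)) : 0 ≤ v i + minShift v := by
  have : (-v i).toNat ≤ minShift v :=
    Finset.le_sup (f := fun i => (-v i).toNat) (Finset.mem_univ i)
  omega

theorem Kext_eq_shiftedK (v : Fin (n + 1) → ℤ) (m : ℕ) (h : ∀ i, 0 ≤ v i + m) :
    Kext n v = shiftedK m v := by
  induction m, minShift_le h using Nat.le_induction with
  | base => rfl
  | succ m hm ih =>
    have hv (i) : 0 ≤ v i + m := by have := add_minShift_nonneg v i; omega
    rw [ih hv, shiftedK_succ hv]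

lemma Kext_of_nonneg {v : Fin (n + 1) → ℤ} (hv : 0 ≤ v) :
    Kext n v = algebraMap (KPoly n) (KRat n) (Kint v) := by
  rw [Kext_eq_shiftedK v 0 fun i => by simpa using hv i, shiftedK_zero]

theorem Kext_natCast (α : Fin (n + 1) → ℕ) :
    Kext n (fun i => (α i : ℤ)) = algebraMap (KPoly n) (KRat n) (Kpoly α) := by
  rw [Kext_of_nonneg fun i => Int.natCast_nonneg _]
  rfl

theorem Kext_eq_shiftOp (v : Fin (n + 1) → ℤ) :
    Kext n v = shiftCoeff qK tK aK v • shiftOp n (Kext n (v + 1)) := by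
  have hv := add_minShift_nonneg v
  rw [Kext_eq_shiftedK v (minShift v + 1) fun i => by have := hv i; omega,
    Kext_eq_shiftedK (v + 1) (minShift v) fun i => by
      have := hv i
      simp only [Pi.add_apply, Pi.one_apply]
      omega,
    shiftedK_succ_eq_shiftOp]

lemma add_one_induction {P : (Fin (n + 1) → ℤ) → Prop} (nonneg : ∀ v, 0 ≤ v → P v)
    (add_one : ∀ v, P (v + 1) → P v) (v : Fin (n + 1) → ℤ) : P v := by
  suffices h : ∀ (m : ℕ) v, (∀ i, 0 ≤ v i + (m : ℤ)) → P v from h _ v (add_minShift_nonneg v)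
  intro m
  induction m with
  | zero => exact fun v hv => nonneg v fun i => by simpa using hv i
  | succ m ih =>
    refine fun v hv => add_one v (ih _ fun i => ?_)
    have := hv i
    simp only [Pi.add_apply, Pi.one_apply]
    omega

end Shift

/-! ### The operators on rational functions -/

section Operators

variable {n : ℕ}

lemma xvar_injective (n : ℕ) : Function.Injective (xvar n) :=
  (IsFractionRing.injective (KPoly n) (KRat n)).comp X_injective

lemma xvar_ne_zero (j : Fin (n + 1)) : xvar n j ≠ 0 :=
  IsFractionRing.to_map_eq_zero_iff.not.2 (X_ne_zero j)

lemma algebraMap_smul_KRat (c : KK) (p : KPoly n) :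
    algebraMap (KPoly n) (KRat n) (c • p) = c • algebraMap (KPoly n) (KRat n) p :=
  map_smul (IsScalarTower.toAlgHom KK (KPoly n) (KRat n)) c p

lemma swapVars_algebraMap (i : Fin n) (p : KPoly n) :
    swapVars n i (algebraMap (KPoly n) (KRat n) p) =
      algebraMap (KPoly n) (KRat n) (rename (Equiv.swap i.castSucc i.succ) p) :=
  IsFractionRing.fieldEquivOfAlgEquiv_algebraMap ..

lemma swapVars_xvar (i : Fin n) (j : Fin (n + 1)) :
    swapVars n i (xvar n j) = xvar n (Equiv.swap i.castSucc i.succ j) := by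
  rw [xvar, swapVars_algebraMap, rename_X, xvar]

lemma Delta_algebraMap (p : KPoly n) :
    Delta n (algebraMap (KPoly n) (KRat n) p) =
      algebraMap (KPoly n) (KRat n) (rotateVars qK p) :=
  IsFractionRing.fieldEquivOfAlgEquiv_algebraMap ..

lemma Delta_xvar_zero :
    Delta n (xvar n 0) = algebraMap KK (KRat n) qK⁻¹ * xvar n (Fin.last n) := by
  rw [xvar, Delta_algebraMap, rotateVars, aeval_X, Fin.cons_zero, map_mul, ← algebraMap_eq,
    ← IsScalarTower.algebraMap_apply, xvar]

lemma Delta_xvar_succ (i : Fin n) : Delta n (xvar n i.succ) = xvar n i.castSucc := by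
  rw [xvar, Delta_algebraMap, rotateVars, aeval_X, Fin.cons_succ, xvar]

lemma HOp_apply (i : Fin n) (f : KRat n) :
    HOp n i f = tK • f +
      (xvar n i.castSucc - algebraMap KK (KRat n) tK * xvar n i.succ) /
        (xvar n i.castSucc - xvar n i.succ) * (swapVars n i f - f) := rfl

lemma PhiOp_apply (f : KRat n) :
    PhiOp n f = (xvar n (Fin.last n) - algebraMap KK (KRat n) (tK ^ (-(n : ℤ)))) * Delta n f := rfl

lemma XiOp_apply (j : Fin (n + 1)) (f : KRat n) :
    XiOp n j f = (xvar n j)⁻¹ * (f + HFrom n j (PhiOp n (HUpTo n j f))) :=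
  (mul_add _ _ _).symm

lemma HOp_algebraMap (i : Fin n) (p : KPoly n) :
    HOp n i (algebraMap (KPoly n) (KRat n) p) =
      algebraMap (KPoly n) (KRat n) (heckePoly tK i p) := by
  have hne : xvar n i.castSucc - xvar n i.succ ≠ 0 :=
    sub_ne_zero.2 fun e => Fin.castSucc_lt_succ.ne (xvar_injective n e)
  rw [HOp_apply, swapVars_algebraMap, ← map_sub, ← mul_dividedDifference, heckePoly]
  simp only [map_add, map_mul, map_sub, ← algebraMap_eq, ← IsScalarTower.algebraMap_apply]
  rw [← xvar, ← xvar, div_mul_eq_mul_div, mul_left_comm, mul_div_cancel_left₀ _ hne,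
    Algebra.smul_def]

lemma PhiOp_algebraMap (p : KPoly n) :
    PhiOp n (algebraMap (KPoly n) (KRat n) p) =
      algebraMap (KPoly n) (KRat n) (phiPoly qK tK p) := by
  rw [PhiOp_apply, Delta_algebraMap, phiPoly, map_mul, map_sub, ← algebraMap_eq,
    ← IsScalarTower.algebraMap_apply, xvar]

lemma prod_map_HOp_algebraMap (l : List (Fin n)) (p : KPoly n) :
    (l.map (HOp n)).prod (algebraMap (KPoly n) (KRat n) p) =
      algebraMap (KPoly n) (KRat n) (l.foldr (heckePoly tK) p) := by
  induction l with
  | nil => rfl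
  | cons i l ih =>
    rw [List.map_cons, List.prod_cons, Module.End.mul_apply, ih, HOp_algebraMap, List.foldr_cons]

lemma XiOp_algebraMap_of_mem_interpLine {v : Fin (n + 1) → ℤ} (hv : 0 ≤ v) {p : KPoly n}
    (hp : p ∈ interpLine qK tK v) (j : Fin (n + 1)) :
    XiOp n j (algebraMap (KPoly n) (KRat n) p) =
      (spectralPoint qK tK v j)⁻¹ • algebraMap (KPoly n) (KRat n) p := by
  rw [XiOp_apply, HUpTo, prod_map_HOp_algebraMap, PhiOp_algebraMap, HFrom, prod_map_HOp_algebraMap]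
  change _ * (_ + algebraMap _ _ (cherednikPoly qK tK j p)) = _
  rw [← map_add, add_cherednikPoly_of_mem_interpLine genericParams_KK hv hp, map_mul, ← xvar,
    inv_mul_cancel_left₀ (xvar_ne_zero j), algebraMap_smul_KRat]

end Operators

section Commutation

variable {n : ℕ}

lemma swapVars_scaleVars (i : Fin n) (f : KRat n) :
    swapVars n i (scaleVars n f) = scaleVars n (swapVars n i f) := by
  refine DFunLike.congr_fun (algHom_ext_xvar (f := ((scaleVars n).trans (swapVars n i)).toAlgHom)
    (g := ((swapVars n i).trans (scaleVars n)).toAlgHom) fun j => ?_) f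
  change swapVars n i (scaleVars n (xvar n j)) = scaleVars n (swapVars n i (xvar n j))
  rw [scaleVars_xvar, map_mul, AlgEquiv.commutes, swapVars_xvar, scaleVars_xvar]

lemma Delta_scaleVars (f : KRat n) : Delta n (scaleVars n f) = scaleVars n (Delta n f) := by
  refine DFunLike.congr_fun (algHom_ext_xvar (f := ((scaleVars n).trans (Delta n)).toAlgHom)
    (g := ((Delta n).trans (scaleVars n)).toAlgHom) fun j => ?_) f
  change Delta n (scaleVars n (xvar n j)) = scaleVars n (Delta n (xvar n j))
  rw [scaleVars_xvar, map_mul, AlgEquiv.commutes]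
  cases j using Fin.cases with
  | zero =>
    rw [Delta_xvar_zero, map_mul, AlgEquiv.commutes, scaleVars_xvar]
    ring
  | succ i => rw [Delta_xvar_succ, scaleVars_xvar]

lemma swapVars_shiftDen (i : Fin n) : swapVars n i (shiftDen n) = shiftDen n := by
  simp only [shiftDen, map_prod, map_sub, map_one, map_mul, AlgEquiv.commutes, swapVars_xvar]
  exact Equiv.prod_comp (Equiv.swap i.castSucc i.succ)
    fun j => 1 - algebraMap KK (KRat n) qK * algebraMap KK (KRat n) (tK ^ n) * xvar n j

/- Up to the factor `-t ^ (1 - N)`, the two linear factors are the one of `Δ (shiftDen n)` and the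
one of `shiftDen n` that contain `x_N`; all other factors agree. -/
lemma mul_shiftDen (n : ℕ) :
    (xvar n (Fin.last n) - algebraMap KK (KRat n) (tK ^ (-(n : ℤ)))) * shiftDen n =
      (algebraMap KK (KRat n) qK * xvar n (Fin.last n) - algebraMap KK (KRat n) (tK ^ (-(n : ℤ)))) *
        Delta n (shiftDen n) := by
  have hDelta : Delta n (shiftDen n) =
      (1 - algebraMap KK (KRat n) (tK ^ n) * xvar n (Fin.last n)) *
        ∏ i : Fin n, (1 - algebraMap KK (KRat n) (qK * tK ^ n) * xvar n i.castSucc) := by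
    simp only [shiftDen, Fin.prod_univ_succ, map_mul (Delta n), map_prod, map_sub, map_one,
      AlgEquiv.commutes, Delta_xvar_zero, Delta_xvar_succ]
    rw [← mul_assoc, ← map_mul, mul_right_comm, mul_inv_cancel₀ qK_ne_zero, one_mul]
  have htn : algebraMap KK (KRat n) (tK ^ (-(n : ℤ))) * algebraMap KK (KRat n) (tK ^ n) = 1 := by
    rw [← map_mul, zpow_neg, zpow_natCast,
      inv_mul_cancel₀ (pow_ne_zero n genericParams_KK.t_ne_zero), map_one]
  rw [hDelta, shiftDen, Fin.prod_univ_castSucc, map_mul]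
  linear_combination ((algebraMap KK (KRat n) qK - 1) * xvar n (Fin.last n) * ∏ i : Fin n,
    (1 - algebraMap KK (KRat n) qK * algebraMap KK (KRat n) (tK ^ n) * xvar n i.castSucc)) * htn

lemma commute_HOp_shiftOp (i : Fin n) : Commute (HOp n i) (shiftOp n) := by
  refine LinearMap.ext fun f => ?_
  have hscale : scaleVars n ((xvar n i.castSucc - algebraMap KK (KRat n) tK * xvar n i.succ) /
      (xvar n i.castSucc - xvar n i.succ)) =
      (xvar n i.castSucc - algebraMap KK (KRat n) tK * xvar n i.succ) /
        (xvar n i.castSucc - xvar n i.succ) := by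
    rw [map_div₀, map_sub, map_sub, map_mul, scaleVars_xvar, scaleVars_xvar, AlgEquiv.commutes,
      mul_left_comm (algebraMap KK (KRat n) tK), ← mul_sub, ← mul_sub, mul_div_mul_left]
    exact (map_ne_zero _).2 qK_ne_zero
  rw [Module.End.mul_apply, Module.End.mul_apply, HOp_apply, HOp_apply, shiftOp_apply,
    shiftOp_apply, map_mul, map_inv₀, swapVars_shiftDen, swapVars_scaleVars, map_add, map_mul,
    hscale, map_sub, Algebra.smul_def, Algebra.smul_def, map_mul, AlgEquiv.commutes]
  ring

lemma commute_PhiOp_shiftOp (n : ℕ) : Commute (PhiOp n) (shiftOp n) := by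
  refine LinearMap.ext fun f => ?_
  have hden := shiftDen_ne_zero n
  have hDelta : Delta n (shiftDen n) ≠ 0 := (map_ne_zero _).2 hden
  rw [Module.End.mul_apply, Module.End.mul_apply, PhiOp_apply, PhiOp_apply, shiftOp_apply,
    shiftOp_apply, map_mul, map_inv₀, Delta_scaleVars, map_mul, map_sub, scaleVars_xvar,
    AlgEquiv.commutes]
  field_simp
  linear_combination scaleVars n (Delta n f) * mul_shiftDen n

lemma commute_prod_map_HOp_shiftOp (l : List (Fin n)) :
    Commute (l.map (HOp n)).prod (shiftOp n) :=
  Commute.list_prod_left _ _ fun T hT => by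
    obtain ⟨i, -, rfl⟩ := List.mem_map.1 hT
    exact commute_HOp_shiftOp i

lemma XiOp_shiftOp (j : Fin (n + 1)) (f : KRat n) :
    XiOp n j (shiftOp n f) = qK • shiftOp n (XiOp n j f) := by
  have hcomm : HFrom n j (PhiOp n (HUpTo n j (shiftOp n f))) =
      shiftOp n (HFrom n j (PhiOp n (HUpTo n j f))) :=
    DFunLike.congr_fun (((commute_prod_map_HOp_shiftOp _).mul_left
      (commute_PhiOp_shiftOp n)).mul_left (commute_prod_map_HOp_shiftOp _)).eq f
  have hq : algebraMap KK (KRat n) qK ≠ 0 := (map_ne_zero _).2 qK_ne_zero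
  have hx := xvar_ne_zero j
  rw [XiOp_apply, XiOp_apply, hcomm, ← map_add, shiftOp_apply, shiftOp_apply, map_mul, map_inv₀,
    scaleVars_xvar, Algebra.smul_def]
  field_simp

end Commutation

/-! ### The identities for all integral vectors -/

section Identities

variable {n : ℕ}

theorem HOp_Kext (i : Fin n) (v : Fin (n + 1) → ℤ) :
    HOp n i (Kext n v) =
      tK • Kext n v + heckeCoeff qK tK i v • (Kext n (swapEntries i v) - Kext n v) := by
  induction v using add_one_induction with
  | nonneg v hv =>
    rw [Kext_of_nonneg hv, Kext_of_nonneg (swapEntries_nonneg hv), HOp_algebraMap,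
      (normalizedFamily_Kint n).heckePoly_eq genericParams_KK (genericPoint_aTau n) hv]
    simp only [map_add, map_sub, algebraMap_smul_KRat]
  | add_one v ih =>
    have hswap : swapEntries i (v + 1) = swapEntries i v + 1 := rfl
    rw [Kext_eq_shiftOp v, map_smul, ← Module.End.mul_apply, (commute_HOp_shiftOp i).eq,
      Module.End.mul_apply, ih, hswap, Kext_eq_shiftOp (swapEntries i v), shiftCoeff_swapEntries,
      heckeCoeff_add_one qK_ne_zero]
    simp only [map_add, map_sub, map_smul]
    simp only [Algebra.smul_def]
    ring

theorem XiOp_Kext (j : Fin (n + 1)) (v : Fin (n + 1) → ℤ) :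
    XiOp n j (Kext n v) = (spectralPoint qK tK v j)⁻¹ • Kext n v := by
  induction v using add_one_induction with
  | nonneg v hv =>
    rw [Kext_of_nonneg hv,
      XiOp_algebraMap_of_mem_interpLine hv ((normalizedFamily_Kint n).mem v hv)]
  | add_one v ih =>
    rw [Kext_eq_shiftOp v, map_smul, XiOp_shiftOp, ih, map_smul, spectralPoint_add_one qK_ne_zero,
      mul_inv, smul_smul qK, mul_inv_cancel_left₀ qK_ne_zero, smul_comm]

theorem PhiOp_Kext (v : Fin (n + 1) → ℤ) :
    PhiOp n (Kext n v) = phiCoeff qK tK aK v • Kext n (natVec v) := by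
  induction v using add_one_induction with
  | nonneg v hv =>
    rw [Kext_of_nonneg hv, Kext_of_nonneg (natVec_nonneg hv), PhiOp_algebraMap,
      (normalizedFamily_Kint n).phiPoly_eq genericParams_KK (genericPoint_aTau n) hv, aTau_zero,
      algebraMap_smul_KRat]
  | add_one v ih =>
    have hnat : natVec (v + 1) = natVec v + 1 := by
      funext i
      cases i using Fin.lastCases <;> simp [natVec, Fin.tail]
    rw [Kext_eq_shiftOp v, map_smul, ← Module.End.mul_apply, (commute_PhiOp_shiftOp n).eq,
      Module.End.mul_apply, ih, hnat, map_smul, smul_smul, shiftCoeff_mul_phiCoeff qK_ne_zero,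
      mul_smul, ← Kext_eq_shiftOp]

lemma onValues_HOp_Kext (i : Fin n) : onValues (HOp n i) (Kext n) = hatH n i (Kext n) :=
  funext fun v => (HOp_Kext i v).trans (by rw [heckeCoeff, ← barK_eq_spectralPoint]; rfl)

lemma onValues_XiOp_Kext (j : Fin (n + 1)) :
    onValues (XiOp n j) (Kext n) = aK • (hatX n j).symm (Kext n) := by
  funext v
  change XiOp n j (Kext n v) = aK • (aK * barK v j)⁻¹ • Kext n v
  rw [XiOp_Kext, smul_smul, mul_inv, mul_inv_cancel_left₀ aK_ne_zero, barK_eq_spectralPoint]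

lemma onValues_PhiOp_Kext :
    onValues (PhiOp n) (Kext n) =
      tK ^ (-(n : ℤ)) •
        (aK ^ 2 • (hatX n 0).symm ((hatDelta n).symm (Kext n)) - (hatDelta n).symm (Kext n)) := by
  funext v
  change PhiOp n (Kext n v) = tK ^ (-(n : ℤ)) •
    (aK ^ 2 • (aK * barK v 0)⁻¹ • Kext n (natVec v) - Kext n (natVec v))
  have ha : aK ^ 2 * (aK * barK v 0)⁻¹ = aK * (barK v 0)⁻¹ := by
    rw [mul_inv, pow_two, mul_assoc, mul_inv_cancel_left₀ aK_ne_zero]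
  rw [PhiOp_Kext, phiCoeff, ← barK_eq_spectralPoint, mul_smul, sub_smul, one_smul, smul_smul, ha]

end Identities

end

end InterpolationMacdonald

theorem mainTheorem8 (n : ℕ) :
    -- the interpolation polynomials exist, are unique, and can be normalized at `aτ`
    (∀ α : Fin (n + 1) → ℕ, ∃! G, IsInterpolation α G) ∧
    (∀ α : Fin (n + 1) → ℕ, evalG α ≠ 0) ∧
    -- `K_v` does not depend on the shift `m` used to define it
    (∀ (v : Fin (n + 1) → ℤ) (m : ℕ), (∀ i, 0 ≤ v i + m) → Kext n v = shiftedK m v) ∧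
    -- `K_v` extends `K_α`
    (∀ α : Fin (n + 1) → ℕ,
      Kext n (fun i => (α i : ℤ)) = algebraMap (KPoly n) (KRat n) (Kpoly α)) ∧
    -- the three identities
    (∀ i : Fin n, onValues (HOp n i) (Kext n) = hatH n i (Kext n)) ∧
    (∀ j : Fin (n + 1),
      onValues (XiOp n j) (Kext n) = aK • (hatX n j).symm (Kext n)) ∧
    onValues (PhiOp n) (Kext n) =
      tK ^ (-(n : ℤ)) •
        (aK ^ 2 • (hatX n 0).symm ((hatDelta n).symm (Kext n)) - (hatDelta n).symm (Kext n)) :=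
  ⟨existsUnique_isInterpolation, evalG_ne_zero, Kext_eq_shiftedK, Kext_natCast, onValues_HOp_Kext,
    onValues_XiOp_Kext, onValues_PhiOp_Kext⟩
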